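/- Let $\mathcal Z$ be a measurable space. A randomized algorithm $A$ for $n$ users with $m$ samples each maps $x=(x_{i,j})_{i\in[n],j\in[m]}\in(\mathcal Z^m)^n$ to a random element of a finite output set, with output probabilities measurable in $x$. For $\varepsilon>0$ it is $\varepsilon$-user-level DP (pure DP, $\delta=0$) if $\Pr[A(x)\in S]\le e^{\varepsilon}\Pr[A(x')\in S]$ for every set $S$ of outputs and all $x,x'$ that differ only in the samples of one user. For a family $\mathfrak P$ of probability distributions on $\mathcal Z$ and $\alpha>0$, let $n_m^{\mathrm{dlearn}(\mathfrak P;\alpha)}(\varepsilon,\delta=0)$ be the smallest $n\ge 0$ (or $\infty$ if there is none) for which there is an $\varepsilon$-user-level DP algorithm whose outputs are distributions on $\mathcal Z$ and which, for every $\mathcal D\in\mathfrak P$, when its $nm$ input samples are i.i.d. from $\mathcal D$, outputs with probability at least $2/3$ some $\mathcal Q$ with $d_{\mathrm{TV}}(\mathcal Q,\mathcal D)\le\alpha$. A finite set $\mathfrak Q$ of distributions on $\mathcal Z$ is an $r$-cover of $\mathfrak P$ if every $\mathcal P\in\mathfrak P$ has some $\mathcal Q\in\mathfrak Q$ with $d_{\mathrm{TV}}(\mathcal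 Q,\mathcal P)\le r$; it is an $r$-packing of $\mathfrak P$ if $\mathfrak Q\subseteq\mathfrak P$ and $d_{\mathrm{TV}}(\mathcal Q,\mathcal Q')\ge r$ for all distinct $\mathcal Q,\mathcal Q'\in\mathfrak Q$. Its size is $\log|\mathfrak Q|$, and its KL-diameter is $\max_{\mathcal Q,\mathcal Q'\in\mathfrak Q}d_{\mathrm{KL}}(\mathcal Q\,\|\,\mathcal Q')$. **Theorem.** There are absolute constants $\kappa,C>0$ and $c\in\mathbb N$ such that the following holds for every measurable space $\mathcal Z$, every family $\mathfrak P$ of probability distributions on $\mathcal Z$, every integer $m\ge 1$ and all $\alpha,\varepsilon\in(0,\kappa]$. 1. If $\mathfrak P$ has a non-empty finite $0.1\alpha$-cover of size $L$, then $$n_m^{\mathrm{dlearn}(\mathfrak P;\alpha)}(\varepsilon,\delta=0)\;\le\; C\, f\,\log^{c}(2+f),\qquad f=\frac{L}{\varepsilon}+\frac{L}{\alpha\varepsilon\sqrt m}+\frac{L}{\alpha^2 m}.$$ 2. If $\beta\in(0,\kappa]$ and $\mathfrak P$ has a finite $3\alpha$-packing of size $L$ with KL-diameter at most $\beta$ (where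 an empty packing counts as having size $0$), then $$n_m^{\mathrm{dlearn}(\mathfrak P;\alpha)}(\varepsilon,\delta=0)\;\ge\; \frac{1}{C}\cdot\frac{f}{\log^{c}(2+f)},\qquad f=\frac{L}{\varepsilon}+\frac{L}{\varepsilon\sqrt{m\beta}}+\frac{L}{m\beta}.$$ -/

import Mathlib

open MeasureTheory
open scoped ENNReal

universe u v

noncomputable section

namespace UserDP

/-- A data set of `n` users holding `m` samples each: `x i j` is the `j`-th sample of user `i`. -/
abbrev Dataset (Z : Type u) (n m : ℕ) : Type u := Fin n → Fin m → Z

/-- Two data sets are user-level neighbours if they agree after the removal of the data of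
some user `i`. -/
def UserNeighbors {Z : Type u} {n m : ℕ} (x y : Dataset Z n m) : Prop :=
  ∃ i : Fin n, ∀ j : Fin n, j ≠ i → x j = y j

/-- A randomized algorithm on data sets of `n` users with `m` samples each. On input `x` it outputs
a random element of `O` with law `law x`. It uses only finitely many outputs, and its output
probabilities are measurable functions of the data. -/
structure Algorithm (Z : Type u) [MeasurableSpace Z] (O : Type v) (n m : ℕ) where
  law : Dataset Z n m → PMF O
  finite_output : ∃ F : Finset O, ∀ x, (law x).support ⊆ (F : Set O)
  measurable_law : ∀ o : O, Measurable fun x => law x o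

/-- The probability, over the coins of the algorithm, that the output on input `x` is in `S`. -/
def Algorithm.prob {Z : Type u} [MeasurableSpace Z] {O : Type v} {n m : ℕ}
    (A : Algorithm Z O n m) (x : Dataset Z n m) (S : Set O) : ℝ≥0∞ :=
  (A.law x).toOuterMeasure S

/-- `(ε, δ)`-user-level differential privacy. -/
def Algorithm.IsUserDP {Z : Type u} [MeasurableSpace Z] {O : Type v} {n m : ℕ}
    (A : Algorithm Z O n m) (ε δ : ℝ) : Prop :=
  ∀ x y : Dataset Z n m, UserNeighbors x y → ∀ S : Set O,
    A.prob x S ≤ ENNReal.ofReal (Real.exp ε) * A.prob y S + ENNReal.ofReal δ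

/-- A statistical task: the distributions that may underlie the data, and for each
distribution the set of correct answers. -/
structure Task (Z : Type u) [MeasurableSpace Z] (O : Type v) where
  valid : Set (ProbabilityMeasure Z)
  correct : ProbabilityMeasure Z → Set O

/-- The law of a data set of `n * m` independent samples from `D`. -/
def sampleLaw {Z : Type u} [MeasurableSpace Z] (D : ProbabilityMeasure Z) (n m : ℕ) :
    Measure (Dataset Z n m) :=
  Measure.pi fun _ : Fin n => Measure.pi fun _ : Fin m => (D : Measure Z)

/-- For every valid `D`, the algorithm gives a correct answer with probability at least `γ`, over
its coins and over independent samples from `D`. -/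
def Algorithm.IsUseful {Z : Type u} [MeasurableSpace Z] {O : Type v} {n m : ℕ}
    (A : Algorithm Z O n m) (T : Task Z O) (γ : ℝ) : Prop :=
  ∀ D ∈ T.valid, ENNReal.ofReal γ ≤ ∫⁻ x, A.prob x (T.correct D) ∂(sampleLaw D n m)

/-- The smallest number `n` of users, with `m` samples each, for which some `(ε, δ)`-user-level DP
algorithm is `γ`-useful for the task `T`; it is `⊤` if there is no such `n`. -/
def userComplexity {Z : Type u} [MeasurableSpace Z] {O : Type v} (T : Task Z O) (m : ℕ)
    (ε δ : ℝ) (γ : ℝ := 2 / 3) : ℕ∞ :=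
  ⨅ n ∈ {n : ℕ | ∃ A : Algorithm Z O n m, A.IsUserDP ε δ ∧ A.IsUseful T γ}, (n : ℕ∞)

/-- Total variation distance: the supremum of `|P E - Q E|` over measurable `E`. -/
def tvDist {Z : Type u} [MeasurableSpace Z] (P Q : ProbabilityMeasure Z) : ℝ :=
  ⨆ E : {E : Set Z // MeasurableSet E},
    |(P : Measure Z).real (E : Set Z) - (Q : Measure Z).real (E : Set Z)|

/-- Kullback-Leibler divergence. -/
def klDist {Z : Type u} [MeasurableSpace Z] (P Q : ProbabilityMeasure Z) : ℝ≥0∞ :=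
  InformationTheory.klDiv (P : Measure Z) (Q : Measure Z)

/-- Distribution learning: the unknown distribution `D` comes from the family `𝓟`, and an answer is
a distribution at total variation distance at most `α` from `D`. -/
def dlearn {Z : Type u} [MeasurableSpace Z] (𝓟 : Set (ProbabilityMeasure Z)) (α : ℝ) :
    Task Z (ProbabilityMeasure Z) where
  valid := 𝓟
  correct D := {Q | tvDist Q D ≤ α}

/-- `𝓠` is an `r`-cover of `𝓟` under the total variation distance. -/
def IsTVCover {Z : Type u} [MeasurableSpace Z] (r : ℝ) (𝓠 : Finset (ProbabilityMeasure Z))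
    (𝓟 : Set (ProbabilityMeasure Z)) : Prop :=
  ∀ P ∈ 𝓟, ∃ Q ∈ 𝓠, tvDist Q P ≤ r

/-- `𝓠` is an `r`-packing of `𝓟` under the total variation distance. -/
def IsTVPacking {Z : Type u} [MeasurableSpace Z] (r : ℝ) (𝓠 : Finset (ProbabilityMeasure Z))
    (𝓟 : Set (ProbabilityMeasure Z)) : Prop :=
  (𝓠 : Set (ProbabilityMeasure Z)) ⊆ 𝓟 ∧ ∀ P ∈ 𝓠, ∀ Q ∈ 𝓠, P ≠ Q → r ≤ tvDist P Q

/-- The size of a cover or a packing is the logarithm of its cardinality. -/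
def logSize {Z : Type u} [MeasurableSpace Z] (𝓠 : Finset (ProbabilityMeasure Z)) : ℝ :=
  Real.log (𝓠.card : ℝ)

/-- The diameter under KL-divergence. -/
def klDiam {Z : Type u} [MeasurableSpace Z] (𝓠 : Finset (ProbabilityMeasure Z)) : ℝ≥0∞ :=
  ⨆ P ∈ 𝓠, ⨆ Q ∈ 𝓠, klDist P Q

/-- The factor `log ^ c` suppressed by soft-O and soft-Omega. The shift by `2` keeps it bounded away
from zero, and changes it by a constant factor only once `f` is bounded away from `1` above. -/
def polylog (c : ℕ) (f : ℝ) : ℝ := Real.log (2 + f) ^ c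

end UserDP

end

/-! Upper bound. The elements of the cover play a private tournament. For a pair `P`, `Q` at
distance at least `0.9 * α`, each user counts the samples in a Scheffé set and clips the centered
count at scale `√m`, the order of its fluctuations. The mean of the result separates distributions
near `P` from those near `Q` with an advantage `γ` of order `min 1 (√m * α)` (`exists_test`). Every
user contributes a number in `[-1, 1]`, so the worst duel of a candidate is a score that one user
moves by at most `2`, and the exponential mechanism applies. With `L` the log-size of the cover, a
candidate near the truth wins all its duels once `n * γ ^ 2` dominates `L`, and wrong candidates are
then unlikely to be selected once `ε * n * γ` dominates `L` (`exists_algorithm`). Solving for `n`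
gives the three terms of `f`.

Lower bound. For a packing of `k` elements the sets of correct answers are disjoint, so some event
has probability at least `2 / 3` on data from `P` and at most `1 / (3 * (k - 1))` on data from `Q`
(`exists_lintegral_prob_le`). Fano's inequality on all samples forces `log k ≲ n * m * β`
(`GibbsBound.log_div_le`). Privacy gives the rest: as a function of one user's data, the acceptance
probability varies by a factor of at most `exp ε`, so moving that user from `P` to `Q` costs a
factor `1 + (exp ε - 1) * t`, where `t` bounds the total variation distance of the `m`-fold
products. Hence `log k ≲ n * ε * t` (`Algorithm.IsUserDP.log_le`), used with `t = 1` and with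
Pinsker's `t = √(m * β / 2)`. KL enters only through its Donsker-Varadhan form `GibbsBound`, which
tensorizes.

No logarithmic factor is lost on either side. -/

namespace UserDP

/-! ### Integration over product measures, one coordinate at a time -/

section Product

variable {X : Type*} [MeasurableSpace X]

theorem lintegral_pi_succ {n : ℕ} (P : Measure X) [SigmaFinite P] {f : (Fin (n + 1) → X) → ℝ≥0∞}
    (hf : Measurable f) :
    ∫⁻ x, f x ∂(Measure.pi fun _ : Fin (n + 1) => P) =
      ∫⁻ b, ∫⁻ a, f (Fin.cons a b) ∂P ∂(Measure.pi fun _ : Fin n => P) := by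
  have h := (measurePreserving_piFinSuccAbove (fun _ : Fin (n + 1) => P) 0).symm
  rw [← h.lintegral_comp hf, lintegral_prod_symm']
  · simp [MeasurableEquiv.piFinSuccAbove_symm_apply, Fin.insertNthEquiv]
  · exact hf.comp (MeasurableEquiv.measurable _)

theorem measurable_finCons {n : ℕ} :
    Measurable fun p : X × (Fin n → X) => (Fin.cons p.1 p.2 : Fin (n + 1) → X) := by
  refine measurable_pi_lambda _ fun i => ?_
  induction i using Fin.cases with
  | zero => simpa using measurable_fst
  | succ i => exact (measurable_pi_apply i).comp measurable_snd

theorem integrable_of_abs_le {P : Measure X} [IsFiniteMeasure P] {f : X → ℝ} (hf : Measurable f)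
    {B : ℝ} (hB : ∀ x, |f x| ≤ B) : Integrable f P :=
  Integrable.of_bound hf.aestronglyMeasurable B (Filter.Eventually.of_forall hB)

theorem integral_pi_succ {n : ℕ} (P : Measure X) [IsProbabilityMeasure P]
    {f : (Fin (n + 1) → X) → ℝ} (hf : Measurable f) {B : ℝ} (hB : ∀ x, |f x| ≤ B) :
    ∫ x, f x ∂(Measure.pi fun _ : Fin (n + 1) => P) =
      ∫ b, ∫ a, f (Fin.cons a b) ∂P ∂(Measure.pi fun _ : Fin n => P) := by
  have h := (measurePreserving_piFinSuccAbove (fun _ : Fin (n + 1) => P) 0).symm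
  rw [← h.integral_comp', integral_prod_symm]
  · simp [MeasurableEquiv.piFinSuccAbove_symm_apply, Fin.insertNthEquiv]
  · exact integrable_of_abs_le (hf.comp (MeasurableEquiv.measurable _)) fun x => hB _

/-- If a change of one coordinate changes `h` by a factor of at most `E`, and a one-dimensional
change of measure costs a factor of `K` for such functions, then the change of the product
measure costs a factor of `K ^ n`. -/
theorem lintegral_pi_le_pow_mul {P Q : Measure X} [SigmaFinite P] [SigmaFinite Q] {E K : ℝ≥0∞}
    (hPQ : ∀ g : X → ℝ≥0∞, Measurable g → (∀ x y, g x ≤ E * g y) →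
      ∫⁻ x, g x ∂P ≤ K * ∫⁻ x, g x ∂Q) :
    ∀ (n : ℕ) (h : (Fin n → X) → ℝ≥0∞), Measurable h →
      (∀ (i : Fin n) (x y : Fin n → X), (∀ j, j ≠ i → x j = y j) → h x ≤ E * h y) →
      ∫⁻ x, h x ∂(Measure.pi fun _ => P) ≤ K ^ n * ∫⁻ x, h x ∂(Measure.pi fun _ => Q) := by
  intro n
  induction n with
  | zero =>
    intro h hm _
    rw [Measure.pi_of_empty (fun _ => P) isEmptyElim, Measure.pi_of_empty (fun _ => Q) isEmptyElim]
    simp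
  | succ n ih =>
    intro h hm hE
    rw [lintegral_pi_succ P hm, lintegral_pi_succ Q hm]
    have hc : Measurable fun p : X × (Fin n → X) => h (Fin.cons p.1 p.2) :=
      hm.comp measurable_finCons
    have hg : Measurable fun b : Fin n → X => ∫⁻ a, h (Fin.cons a b) ∂Q := hc.lintegral_prod_left'
    calc
      _ ≤ ∫⁻ b, K * ∫⁻ a, h (Fin.cons a b) ∂Q ∂(Measure.pi fun _ : Fin n => P) := by
        refine lintegral_mono fun b => hPQ _ (hc.comp measurable_prodMk_right) fun x y => ?_
        refine hE 0 _ _ fun j hj => ?_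
        obtain ⟨k, rfl⟩ := Fin.exists_succ_eq.2 hj
        simp
      _ = K * ∫⁻ b, ∫⁻ a, h (Fin.cons a b) ∂Q ∂(Measure.pi fun _ : Fin n => P) :=
        lintegral_const_mul _ hg
      _ ≤ K * (K ^ n * ∫⁻ b, ∫⁻ a, h (Fin.cons a b) ∂Q ∂(Measure.pi fun _ : Fin n => Q)) := by
        gcongr
        -- Averaging over the first coordinate preserves the factor-`E` condition in the remaining
        -- ones.
        refine ih _ hg fun i x y hxy => ?_
        calc
          _ ≤ ∫⁻ a, E * h (Fin.cons a y) ∂Q := by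
            refine lintegral_mono fun a => hE i.succ _ _ fun j hj => ?_
            induction j using Fin.cases with
            | zero => simp
            | succ j => simpa using hxy j fun h => hj (by rw [h])
          _ = _ := lintegral_const_mul _ (hc.comp measurable_prodMk_right)
      _ = _ := by rw [pow_succ', mul_assoc]

end Product

/-! ### The variational form of KL divergence and its consequences -/

section Gibbs

variable {X : Type*} [MeasurableSpace X]

/-- The Donsker-Varadhan inequality with divergence `κ`, for bounded functions. -/
def GibbsBound (P Q : Measure X) (κ : ℝ) : Prop :=
  ∀ f : X → ℝ, Measurable f → (∃ B, ∀ x, |f x| ≤ B) →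
    ∫ x, f x ∂P ≤ κ + Real.log (∫ x, Real.exp (f x) ∂Q)

theorem abs_exp_le {t B : ℝ} (h : |t| ≤ B) : |Real.exp t| ≤ Real.exp B := by
  rw [abs_of_pos (Real.exp_pos t)]
  exact Real.exp_le_exp.2 (le_of_abs_le h)

/-- The gap in the inequality is the divergence of `P` from the tilted measure `Q.tilted f`, which
is nonnegative. -/
theorem GibbsBound.of_klDiv_le {P Q : Measure X} [IsProbabilityMeasure P] [IsProbabilityMeasure Q]
    {β : ℝ} (hβ : 0 ≤ β) (h : InformationTheory.klDiv P Q ≤ ENNReal.ofReal β) :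
    GibbsBound P Q β := by
  rintro f hf ⟨B, hB⟩
  obtain ⟨hac, hint⟩ := InformationTheory.klDiv_ne_top_iff.1 (ne_top_of_le_ne_top (by simp) h)
  have hfP : Integrable f P := integrable_of_abs_le hf hB
  have hfQ : Integrable (fun x => Real.exp (f x)) Q :=
    integrable_of_abs_le hf.exp fun x => abs_exp_le (hB x)
  have h1 := integral_llr_tilted_right hac hfP hfQ hint
  have hac' : P ≪ Q.tilted f := hac.trans (absolutelyContinuous_tilted hfQ)
  have := isProbabilityMeasure_tilted hfQ
  have h2 := InformationTheory.integral_llr_add_sub_measure_univ_nonneg hac'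
    (integrable_llr_tilted_right hac hfP hint hfQ)
  have h3 := InformationTheory.toReal_klDiv_of_measure_eq hac (by simp)
  have h4 := ENNReal.toReal_le_of_le_ofReal hβ h
  simp only [probReal_univ] at h2
  linarith

/-- Tensorization: the one-coordinate bound is applied on each fiber, and the inductive bound to the
log-partition function `g` of the fibers. Since `exp g` is the inner integral, the two logarithms
recombine. -/
theorem GibbsBound.pi {P Q : Measure X} [IsProbabilityMeasure P] [IsProbabilityMeasure Q]
    {κ : ℝ} (h : GibbsBound P Q κ) (n : ℕ) :
    GibbsBound (Measure.pi fun _ : Fin n => P) (Measure.pi fun _ : Fin n => Q) (n * κ) := by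
  induction n with
  | zero =>
    rintro f - -
    rw [Measure.pi_of_empty (fun _ => P) isEmptyElim, Measure.pi_of_empty (fun _ => Q) isEmptyElim]
    simp
  | succ n ih =>
    rintro f hf ⟨B, hB⟩
    have hc : Measurable fun p : X × (Fin n → X) => f (Fin.cons p.1 p.2) :=
      hf.comp measurable_finCons
    have hcb (b : Fin n → X) : Measurable fun a => f (Fin.cons a b) :=
      hc.comp measurable_prodMk_right
    set g : (Fin n → X) → ℝ := fun b => Real.log (∫ a, Real.exp (f (Fin.cons a b)) ∂Q) with hg
    have hJ (b : Fin n → X) : Real.exp (-B) ≤ ∫ a, Real.exp (f (Fin.cons a b)) ∂Q ∧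
        ∫ a, Real.exp (f (Fin.cons a b)) ∂Q ≤ Real.exp B := by
      have hi : Integrable (fun a => Real.exp (f (Fin.cons a b))) Q :=
        integrable_of_abs_le (hcb b).exp fun a => abs_exp_le (hB _)
      constructor
      · simpa using integral_mono (μ := Q) (integrable_const (Real.exp (-B))) hi
          fun a => Real.exp_le_exp.2 (abs_le.1 (hB (Fin.cons a b))).1
      · simpa using integral_mono (μ := Q) hi (integrable_const (Real.exp B))
          fun a => Real.exp_le_exp.2 (abs_le.1 (hB (Fin.cons a b))).2
    have hJ0 (b : Fin n → X) : 0 < ∫ a, Real.exp (f (Fin.cons a b)) ∂Q :=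
      (Real.exp_pos _).trans_le (hJ b).1
    have hgm : Measurable g := by
      refine Measurable.log ?_
      exact (StronglyMeasurable.integral_prod_left' (f := fun p : X × (Fin n → X) =>
        Real.exp (f (Fin.cons p.1 p.2))) hc.exp.stronglyMeasurable).measurable
    have hgB (b : Fin n → X) : |g b| ≤ B := by
      rw [abs_le]
      exact ⟨(Real.le_log_iff_exp_le (hJ0 b)).2 (hJ b).1, (Real.log_le_iff_le_exp (hJ0 b)).2 (hJ b).2⟩
    have hin : Measurable fun b : Fin n → X => ∫ a, f (Fin.cons a b) ∂P :=
      (StronglyMeasurable.integral_prod_left' (f := fun p : X × (Fin n → X) =>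
        f (Fin.cons p.1 p.2)) hc.stronglyMeasurable).measurable
    have hinB (b : Fin n → X) : |∫ a, f (Fin.cons a b) ∂P| ≤ B := by
      simpa using norm_integral_le_of_norm_le_const (μ := P) (f := fun a => f (Fin.cons a b))
        (Filter.Eventually.of_forall fun a => hB _)
    rw [integral_pi_succ P hf hB, integral_pi_succ Q hf.exp fun x => abs_exp_le (hB x)]
    calc
      _ ≤ ∫ b, (κ + g b) ∂(Measure.pi fun _ : Fin n => P) := by
        refine integral_mono (integrable_of_abs_le hin hinB)
          ((integrable_const κ).add (integrable_of_abs_le hgm hgB)) fun b => ?_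
        exact h _ (hcb b) ⟨B, fun a => hB _⟩
      _ = κ + ∫ b, g b ∂(Measure.pi fun _ : Fin n => P) := by
        rw [integral_add (integrable_const κ) (integrable_of_abs_le hgm hgB)]
        simp
      _ ≤ κ + (n * κ + Real.log (∫ b, Real.exp (g b) ∂(Measure.pi fun _ : Fin n => Q))) := by
        gcongr
        exact ih g hgm ⟨B, hgB⟩
      _ = _ := by
        simp only [hg, Real.exp_log (hJ0 _)]
        push_cast
        ring

/-- Pinsker's inequality for functions. -/
theorem GibbsBound.integral_sub_le {P Q : Measure X} [IsProbabilityMeasure Q]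
    {κ : ℝ} (h : GibbsBound P Q κ) {f : X → ℝ} (hf : Measurable f) (hf0 : ∀ x, f x ∈ Set.Icc 0 1) :
    ∫ x, f x ∂P - ∫ x, f x ∂Q ≤ √(κ / 2) := by
  set d := ∫ x, f x ∂P - ∫ x, f x ∂Q with hd
  have hs := ProbabilityTheory.hasSubgaussianMGF_of_mem_Icc (μ := Q) hf.aemeasurable
    (Filter.Eventually.of_forall hf0)
  -- The slope `4 * d` maximizes `s * d - s ^ 2 / 8` over `s`, the term `s ^ 2 / 8` being
  -- Hoeffding's bound for values in `[0, 1]`.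
  have h1 := hs.mgf_le (4 * d)
  have h2 := h (fun x => 4 * d * f x) (hf.const_mul _)
    ⟨|4 * d|, fun x => by
      rw [abs_mul, abs_of_nonneg (hf0 x).1]
      exact mul_le_of_le_one_right (abs_nonneg _) (hf0 x).2⟩
  have h3 : ∫ x, Real.exp (4 * d * f x) ∂Q =
      Real.exp (4 * d * ∫ x, f x ∂Q) *
        ProbabilityTheory.mgf (fun x => f x - ∫ x, f x ∂Q) Q (4 * d) := by
    rw [ProbabilityTheory.mgf, ← integral_const_mul]
    congr 1 with x
    rw [← Real.exp_add]
    ring_nf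
  have h4 : Real.log (∫ x, Real.exp (4 * d * f x) ∂Q) ≤ 4 * d * ∫ x, f x ∂Q + 2 * d ^ 2 := by
    have hpos : 0 < ∫ x, Real.exp (4 * d * f x) ∂Q := by
      rw [h3]
      exact mul_pos (Real.exp_pos _) (ProbabilityTheory.mgf_pos (hs.integrable_exp_mul _))
    rw [Real.log_le_iff_le_exp hpos, h3, Real.exp_add]
    gcongr
    refine h1.trans (Real.exp_le_exp.2 (le_of_eq ?_))
    simp
    ring
  rw [integral_const_mul] at h2
  refine Real.le_sqrt_of_sq_le ?_
  nlinarith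

/-- A change of measure, for functions whose values lie within a factor of `exp ε`. -/
theorem lintegral_le_of_integral_sub_le {P Q : Measure X} [IsProbabilityMeasure P]
    [IsProbabilityMeasure Q] {t ε : ℝ} (ht : 0 ≤ t) (hε : 0 < ε)
    (h : ∀ f : X → ℝ, Measurable f → (∀ x, f x ∈ Set.Icc 0 1) →
      ∫ x, f x ∂P - ∫ x, f x ∂Q ≤ t)
    {g : X → ℝ≥0∞} (hg : Measurable g)
    (hgE : ∀ x y, g x ≤ ENNReal.ofReal (Real.exp ε) * g y) :
    ∫⁻ x, g x ∂P ≤ ENNReal.ofReal (1 + (Real.exp ε - 1) * t) * ∫⁻ x, g x ∂Q := by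
  have hE : 0 < Real.exp ε - 1 := by linarith [Real.add_one_lt_exp hε.ne']
  have hK : 0 < 1 + (Real.exp ε - 1) * t := by positivity
  obtain ⟨y0⟩ : Nonempty X := P.nonempty_of_neZero
  by_cases htop : ∃ y, g y = ∞
  · obtain ⟨y, hy⟩ := htop
    have hall (x : X) : g x = ∞ := by
      by_contra hx
      have := hgE y x
      rw [hy, top_le_iff] at this
      exact ENNReal.mul_ne_top (by simp) hx this
    simp [hall, ENNReal.mul_top, hK]
  push Not at htop
  set r : X → ℝ := fun x => (g x).toReal with hr
  have hrm : Measurable r := hg.ennreal_toReal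
  have hr0 (x : X) : 0 ≤ r x := ENNReal.toReal_nonneg
  have hrE (x y : X) : r x ≤ Real.exp ε * r y := by
    have := ENNReal.toReal_mono (ENNReal.mul_ne_top (by simp) (htop y)) (hgE x y)
    rwa [ENNReal.toReal_mul, ENNReal.toReal_ofReal (Real.exp_pos ε).le] at this
  -- All values lie in `[a, exp ε * a]`. Rescaling this interval to `[0, 1]` bounds the difference
  -- of the integrals by `t * (exp ε - 1) * a`, and `a` is at most the mean under `Q`.
  set a := ⨅ x, r x with ha
  have hbdd : BddBelow (Set.range r) := ⟨0, by rintro _ ⟨x, rfl⟩; exact hr0 x⟩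
  have : Nonempty X := ⟨y0⟩
  have har (x : X) : a ≤ r x := ciInf_le hbdd x
  have ha0 : 0 ≤ a := le_ciInf hr0
  have hra (x : X) : r x ≤ Real.exp ε * a := by
    rw [← div_le_iff₀' (Real.exp_pos ε)]
    refine le_ciInf fun y => ?_
    rw [div_le_iff₀' (Real.exp_pos ε)]
    exact hrE x y
  have hrB (x : X) : |r x| ≤ Real.exp ε * a := by
    rw [abs_of_nonneg (hr0 x)]
    exact hra x
  have hiP : Integrable r P := integrable_of_abs_le hrm hrB
  have hiQ : Integrable r Q := integrable_of_abs_le hrm hrB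
  have key : ∫ x, r x ∂P ≤ (1 + (Real.exp ε - 1) * t) * ∫ x, r x ∂Q := by
    have haQ : a ≤ ∫ x, r x ∂Q := by
      simpa using integral_mono (μ := Q) (integrable_const a) hiQ har
    rcases ha0.eq_or_lt with h0 | h0
    · have hz (x : X) : r x = 0 := le_antisymm (by simpa [← h0] using hra x) (hr0 x)
      simp [hz]
    · have hD : 0 < (Real.exp ε - 1) * a := by positivity
      have h1 := h (fun x => (r x - a) / ((Real.exp ε - 1) * a)) ((hrm.sub_const a).div_const _)
        fun x => ⟨div_nonneg (sub_nonneg.2 (har x)) hD.le, by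
          rw [div_le_one hD]
          linarith [hra x]⟩
      rw [integral_div, integral_div, integral_sub hiP (integrable_const a),
        integral_sub hiQ (integrable_const a), ← sub_div, div_le_iff₀ hD] at h1
      simp only [integral_const, probReal_univ, one_smul] at h1
      have h2 : t * ((Real.exp ε - 1) * a) ≤ t * ((Real.exp ε - 1) * ∫ x, r x ∂Q) := by gcongr
      linarith
  have hgr (x : X) : g x = ENNReal.ofReal (r x) := (ENNReal.ofReal_toReal (htop x)).symm
  simp only [hgr]
  rw [← ofReal_integral_eq_lintegral_ofReal hiP (Filter.Eventually.of_forall hr0),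
    ← ofReal_integral_eq_lintegral_ofReal hiQ (Filter.Eventually.of_forall hr0),
    ← ENNReal.ofReal_mul hK.le]
  exact ENNReal.ofReal_le_ofReal key

end Gibbs

/-! ### Output probabilities of an algorithm -/

section Algorithm

variable {Z : Type u} [MeasurableSpace Z] {O : Type v} {n m : ℕ}

theorem Algorithm.measurable_prob (A : Algorithm Z O n m) (S : Set O) :
    Measurable fun x => A.prob x S := by
  classical
  obtain ⟨F, hF⟩ := A.finite_output
  have h (x : Dataset Z n m) : A.prob x S = ∑ o ∈ F, if o ∈ S then A.law x o else 0 := by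
    rw [Algorithm.prob, PMF.toOuterMeasure_apply, tsum_eq_sum (s := F)]
    · rfl
    · intro o ho
      refine Set.indicator_apply_eq_zero.2 fun _ => ?_
      by_contra hne
      exact ho (hF x ((PMF.mem_support_iff _ _).2 hne))
  simp only [h]
  refine Finset.measurable_fun_sum _ fun o _ => ?_
  split_ifs
  · exact A.measurable_law o
  · exact measurable_const

theorem sum_toOuterMeasure_le_one {ι : Type*} (p : PMF O) (s : Finset ι) (S : ι → Set O)
    (hS : (s : Set ι).PairwiseDisjoint S) : ∑ i ∈ s, p.toOuterMeasure (S i) ≤ 1 := by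
  let _ : MeasurableSpace O := ⊤
  have h (T : Set O) : p.toOuterMeasure T = p.toMeasure T :=
    (PMF.toMeasure_apply_eq_toOuterMeasure_apply p trivial).symm
  simp only [h]
  rw [← measure_biUnion_finset hS fun _ _ => trivial]
  exact prob_le_one

theorem Algorithm.prob_le_one (A : Algorithm Z O n m) (x : Dataset Z n m) (S : Set O) :
    A.prob x S ≤ 1 := by
  simpa [Algorithm.prob] using sum_toOuterMeasure_le_one (A.law x) (Finset.univ : Finset Unit) (fun _ => S)
    (by simp)

instance (D : ProbabilityMeasure Z) : IsProbabilityMeasure (sampleLaw D n m) := by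
  unfold sampleLaw
  infer_instance

end Algorithm

/-! ### Total variation as a pseudometric -/

section TotalVariation

variable {Z : Type u} [MeasurableSpace Z]

theorem bddAbove_tvDist (P Q : ProbabilityMeasure Z) :
    BddAbove (Set.range fun E : {E : Set Z // MeasurableSet E} =>
      |(P : Measure Z).real (E : Set Z) - (Q : Measure Z).real (E : Set Z)|) := by
  refine ⟨1, ?_⟩
  rintro _ ⟨E, rfl⟩
  have h1 : (P : Measure Z).real E ≤ 1 := measureReal_le_one
  have h2 : (Q : Measure Z).real E ≤ 1 := measureReal_le_one
  have h3 : 0 ≤ (P : Measure Z).real E := measureReal_nonneg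
  have h4 : 0 ≤ (Q : Measure Z).real E := measureReal_nonneg
  exact abs_le.2 ⟨by linarith, by linarith⟩

theorem abs_sub_le_tvDist (P Q : ProbabilityMeasure Z) {E : Set Z} (hE : MeasurableSet E) :
    |(P : Measure Z).real E - (Q : Measure Z).real E| ≤ tvDist P Q :=
  le_ciSup (bddAbove_tvDist P Q) ⟨E, hE⟩

theorem tvDist_comm (P Q : ProbabilityMeasure Z) : tvDist P Q = tvDist Q P := by
  simp only [tvDist, abs_sub_comm]

theorem tvDist_triangle (P Q R : ProbabilityMeasure Z) :
    tvDist P R ≤ tvDist P Q + tvDist Q R := by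
  have : Nonempty {E : Set Z // MeasurableSet E} := ⟨⟨∅, MeasurableSet.empty⟩⟩
  refine ciSup_le fun E => (abs_sub_le _ ((Q : Measure Z).real E) _).trans ?_
  exact add_le_add (abs_sub_le_tvDist P Q E.2) (abs_sub_le_tvDist Q R E.2)

end TotalVariation

/-! ### The lower bound: Fano's inequality and private change of measure -/

section LowerBound

/-- Fano's inequality for a test that accepts with probability at least `2 / 3` under `P`, and at
most `1 / (3 (k - 1))` under `Q`. -/
theorem GibbsBound.log_div_le {X : Type*} [MeasurableSpace X] {P Q : Measure X}
    [IsProbabilityMeasure P] [IsProbabilityMeasure Q] {κ : ℝ} (hPQ : GibbsBound P Q κ)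
    {h : X → ℝ} (hm : Measurable h) (h01 : ∀ x, h x ∈ Set.Icc 0 1) {k : ℕ} (hk : 2 ≤ k)
    (hP : 2 / 3 ≤ ∫ x, h x ∂P) (hQ : ∫ x, h x ∂Q ≤ 1 / (3 * (k - 1))) :
    Real.log k / 20 ≤ κ := by
  have hk' : (2 : ℝ) ≤ k := by exact_mod_cast hk
  -- With this tilt, `exp l` cancels the bound on the mean under `Q`, so the exponential moment is
  -- at most `2`.
  set l := Real.log (3 * (k - 1)) with hl
  have hpos : (0 : ℝ) < 3 * (k - 1) := by linarith
  have hl0 : 0 ≤ l := Real.log_nonneg (by linarith)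
  have hel : Real.exp l = 3 * (k - 1) := Real.exp_log hpos
  have hB (x : X) : |h x| ≤ 1 := by
    rw [abs_of_nonneg (h01 x).1]
    exact (h01 x).2
  have hlB (x : X) : |l * h x| ≤ l := by
    rw [abs_mul, abs_of_nonneg hl0]
    exact mul_le_of_le_one_right hl0 (hB x)
  have h1 := hPQ (fun x => l * h x) (hm.const_mul l) ⟨l, hlB⟩
  rw [integral_const_mul] at h1
  have hi : Integrable (fun x => Real.exp (l * h x)) Q :=
    integrable_of_abs_le (hm.const_mul l).exp fun x => abs_exp_le (hlB x)
  have hih : Integrable h Q := integrable_of_abs_le hm hB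
  have h2 : ∫ x, Real.exp (l * h x) ∂Q ≤ 2 := by
    calc
      _ ≤ ∫ x, (1 + (Real.exp l - 1) * h x) ∂Q := by
        refine integral_mono hi ((integrable_const 1).add (hih.const_mul _)) fun x => ?_
        have := convexOn_exp.2 (Set.mem_univ 0) (Set.mem_univ l) (sub_nonneg.2 (h01 x).2)
          (h01 x).1 (by ring)
        simp only [smul_eq_mul, mul_zero, zero_add, Real.exp_zero, mul_one] at this
        rw [mul_comm l]
        linarith
      _ = 1 + (Real.exp l - 1) * ∫ x, h x ∂Q := by
        rw [integral_add (integrable_const 1) (hih.const_mul _), integral_const_mul]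
        simp
      _ ≤ 1 + 3 * (k - 1) * (1 / (3 * (k - 1))) := by
        have : 0 ≤ ∫ x, h x ∂Q := integral_nonneg fun x => (h01 x).1
        rw [hel]
        nlinarith
      _ = 2 := by
        rw [mul_one_div_cancel hpos.ne']
        norm_num
  have h3 : 0 < ∫ x, Real.exp (l * h x) ∂Q := by
    have h4 := integral_mono (μ := Q) (integrable_const (1 : ℝ)) hi fun x =>
      Real.one_le_exp (mul_nonneg hl0 (h01 x).1)
    rw [integral_const, probReal_univ, one_smul] at h4
    linarith
  have h5 : Real.log (∫ x, Real.exp (l * h x) ∂Q) ≤ Real.log 2 := Real.log_le_log h3 h2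
  have h6 : Real.log 3 - Real.log 2 + Real.log k ≤ l := by
    rw [← Real.log_div (by norm_num) (by norm_num), ← Real.log_mul (by norm_num) (by linarith)]
    exact Real.log_le_log (by linarith) (by linarith)
  -- This is the case `k = 2` of the final inequality; larger `k` follows from `h8`.
  have h7 : 63 * Real.log 2 ≤ 40 * Real.log 3 := by
    have := Real.log_le_log (x := 2 ^ 63) (y := 3 ^ 40) (by norm_num) (by norm_num)
    rwa [Real.log_pow, Real.log_pow] at this
  have h8 : Real.log 2 ≤ Real.log k := Real.log_le_log (by norm_num) hk'
  have h9 : 2 / 3 * l ≤ l * ∫ x, h x ∂P := by nlinarith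
  linarith

variable {Z : Type u} [MeasurableSpace Z] {n m : ℕ}

/-- Two members of a packing such that the answers correct for the first one are unlikely on data
from the second one. -/
theorem exists_lintegral_prob_le {O : Type v} (A : Algorithm Z O n m)
    {𝓠 : Finset (ProbabilityMeasure Z)} (h2 : 2 ≤ 𝓠.card) (S : ProbabilityMeasure Z → Set O)
    (hS : (𝓠 : Set (ProbabilityMeasure Z)).PairwiseDisjoint S)
    (hA : ∀ D ∈ 𝓠, ENNReal.ofReal (2 / 3) ≤ ∫⁻ x, A.prob x (S D) ∂(sampleLaw D n m)) :
    ∃ P ∈ 𝓠, ∃ Q ∈ 𝓠, ∫⁻ x, A.prob x (S P) ∂(sampleLaw Q n m) ≤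
      ENNReal.ofReal (1 / (3 * (𝓠.card - 1))) := by
  classical
  obtain ⟨Q, hQ⟩ : 𝓠.Nonempty := Finset.card_pos.1 (by omega)
  have hsum : ∑ P ∈ 𝓠, ∫⁻ x, A.prob x (S P) ∂(sampleLaw Q n m) ≤ 1 := by
    rw [← lintegral_finsetSum _ fun P _ => A.measurable_prob (S P)]
    calc
      _ ≤ ∫⁻ _, 1 ∂(sampleLaw Q n m) :=
        lintegral_mono fun x => sum_toOuterMeasure_le_one (A.law x) 𝓠 S hS
      _ = 1 := by simp
  -- The answers correct for `Q` already take mass `2 / 3` on data from `Q`, so the other members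
  -- share at most `1 / 3`, and one of them gets at most the average.
  rw [← Finset.add_sum_erase _ _ hQ] at hsum
  have h3 : (2 : ℝ) ≤ 𝓠.card := by exact_mod_cast h2
  have hcard : ((𝓠.erase Q).card : ℝ) = 𝓠.card - 1 := by
    rw [Finset.card_erase_of_mem hQ, Nat.cast_sub (by omega)]
    simp
  by_contra! hcon
  have hlow : ∑ P ∈ 𝓠.erase Q, ENNReal.ofReal (1 / (3 * ((𝓠.card : ℝ) - 1))) <
      ∑ P ∈ 𝓠.erase Q, ∫⁻ x, A.prob x (S P) ∂(sampleLaw Q n m) :=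
    ENNReal.sum_lt_sum_of_nonempty (Finset.card_pos.1 (by
      rw [Finset.card_erase_of_mem hQ]
      omega)) fun P hP => hcon P (Finset.mem_of_mem_erase hP) Q hQ
  rw [Finset.sum_const, nsmul_eq_mul, ← ENNReal.ofReal_natCast, hcard,
    ← ENNReal.ofReal_mul (by linarith)] at hlow
  have h4 : ((𝓠.card : ℝ) - 1) * (1 / (3 * (𝓠.card - 1))) = 1 / 3 := by
    have : (𝓠.card : ℝ) - 1 ≠ 0 := by linarith
    field_simp
  rw [h4] at hlow
  have h5 := (ENNReal.add_lt_add_of_le_of_lt (by simp) (hA Q hQ) hlow).trans_le hsum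
  rw [← ENNReal.ofReal_add (by norm_num) (by norm_num)] at h5
  norm_num at h5

/-- The privacy cost of a change of measure between the laws of the data of each user. -/
theorem Algorithm.IsUserDP.log_le {O : Type v} {A : Algorithm Z O n m} {ε : ℝ}
    (hA : A.IsUserDP ε 0) (hε : 0 < ε) (hε1 : ε ≤ 1) {P Q : ProbabilityMeasure Z} {t : ℝ}
    (ht : 0 ≤ t)
    (hPQ : ∀ f : (Fin m → Z) → ℝ, Measurable f → (∀ x, f x ∈ Set.Icc 0 1) →
      ∫ x, f x ∂(Measure.pi fun _ => (P : Measure Z)) -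
        ∫ x, f x ∂(Measure.pi fun _ => (Q : Measure Z)) ≤ t)
    {S : Set O} {k : ℕ} (hk : 2 ≤ k)
    (hP : ENNReal.ofReal (2 / 3) ≤ ∫⁻ x, A.prob x S ∂(sampleLaw P n m))
    (hQ : ∫⁻ x, A.prob x S ∂(sampleLaw Q n m) ≤ ENNReal.ofReal (1 / (3 * (k - 1)))) :
    Real.log k ≤ 2 * n * (ε * t) := by
  have hk' : (2 : ℝ) ≤ k := by exact_mod_cast hk
  have hE : 0 < Real.exp ε - 1 := by linarith [Real.add_one_lt_exp hε.ne']
  have hK : 0 ≤ 1 + (Real.exp ε - 1) * t := by positivity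
  have h1 := lintegral_pi_le_pow_mul (P := Measure.pi fun _ : Fin m => (P : Measure Z))
    (Q := Measure.pi fun _ : Fin m => (Q : Measure Z)) (E := ENNReal.ofReal (Real.exp ε))
    (K := ENNReal.ofReal (1 + (Real.exp ε - 1) * t))
    (fun g hg hgE => lintegral_le_of_integral_sub_le ht hε hPQ hg hgE) n
    (fun x => A.prob x S) (A.measurable_prob S)
    (fun i x y hxy => by simpa using hA x y ⟨i, hxy⟩ S)
  have h2 := (hP.trans h1).trans (mul_le_mul_right hQ _)
  rw [← ENNReal.ofReal_pow hK, ← ENNReal.ofReal_mul (by positivity),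
    ENNReal.ofReal_le_ofReal_iff (by
      have : 0 < 3 * ((k : ℝ) - 1) := by linarith
      positivity), mul_one_div, le_div_iff₀ (by linarith)] at h2
  have h3 : 1 + (Real.exp ε - 1) * t ≤ Real.exp (2 * ε * t) := by
    have h4 : Real.exp ε - 1 ≤ 2 * ε := by
      have := Real.abs_exp_sub_one_le (x := ε) (by rw [abs_of_pos hε]; exact hε1)
      rw [abs_of_pos hε] at this
      exact (le_abs_self _).trans this
    have h5 := Real.add_one_le_exp (2 * ε * t)
    nlinarith
  have h6 : (k : ℝ) ≤ Real.exp (2 * n * (ε * t)) := by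
    calc
      -- The right side is `2 * (k - 1)`, so `2 ≤ k` is exactly what is needed.
      (k : ℝ) ≤ 2 / 3 * (3 * (k - 1)) := by linarith
      _ ≤ _ := h2
      _ ≤ Real.exp (2 * ε * t) ^ n := pow_le_pow_left₀ hK h3 n
      _ = _ := by
        rw [← Real.exp_nat_mul]
        ring_nf
  rwa [Real.log_le_iff_le_exp (by linarith)]

/-- The three terms are bounded separately: `2 * n` for each of the two privacy arguments and `20 *
n` for Fano. -/
theorem lower_bound {𝓟 : Set (ProbabilityMeasure Z)} (hm : 0 < m) {α ε β : ℝ} (hα : 0 < α)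
    (hε : 0 < ε) (hε1 : ε ≤ 1) (hβ : 0 < β) {𝓠 : Finset (ProbabilityMeasure Z)}
    (h𝓠 : IsTVPacking (3 * α) 𝓠 𝓟) (hdiam : klDiam 𝓠 ≤ ENNReal.ofReal β)
    {A : Algorithm Z (ProbabilityMeasure Z) n m} (hA : A.IsUserDP ε 0)
    (hU : A.IsUseful (dlearn 𝓟 α) (2 / 3)) :
    logSize 𝓠 / ε + logSize 𝓠 / (ε * √((m : ℝ) * β)) + logSize 𝓠 / (m * β) ≤ 24 * n := by
  -- A packing with at most one element has log-size zero; the empty one relies on `Real.log 0 = 0`.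
  rcases lt_or_ge 𝓠.card 2 with h2 | h2
  · have : logSize 𝓠 = 0 := by
      unfold logSize
      interval_cases 𝓠.card <;> simp
    simp [this]
  obtain ⟨P, hP, Q, hQ, hPQ⟩ := exists_lintegral_prob_le A h2 (fun D => {R | tvDist R D ≤ α})
    (by
      intro P hP Q hQ hne
      refine Set.disjoint_left.2 fun R hRP hRQ => ?_
      have h1 := h𝓠.2 P hP Q hQ hne
      have h3 := tvDist_triangle P R Q
      rw [tvDist_comm P R] at h3
      simp only [Set.mem_ofPred_eq] at hRP hRQ
      linarith)
    fun D hD => hU D (h𝓠.1 hD)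
  have hPU : ENNReal.ofReal (2 / 3) ≤
      ∫⁻ x, A.prob x {R | tvDist R P ≤ α} ∂(sampleLaw P n m) := hU P (h𝓠.1 hP)
  have hkl : InformationTheory.klDiv (P : Measure Z) (Q : Measure Z) ≤ ENNReal.ofReal β :=
    (le_iSup₂_of_le (f := fun P (_ : P ∈ 𝓠) => ⨆ Q ∈ 𝓠, klDist P Q) P hP
      (le_iSup₂_of_le (f := fun Q (_ : Q ∈ 𝓠) => klDist P Q) Q hQ le_rfl)).trans hdiam
  have hG := (GibbsBound.of_klDiv_le hβ.le hkl).pi m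
  have hmβ : 0 < (m : ℝ) * β := by positivity
  have e1 := hA.log_le hε hε1 (t := 1) zero_le_one
    (fun f hf h01 => by
      have h3 : ∫ x, f x ∂(Measure.pi fun _ => (P : Measure Z)) ≤ 1 := by
        have hi : Integrable f (Measure.pi fun _ => (P : Measure Z)) :=
          integrable_of_abs_le hf fun x => (abs_of_nonneg (h01 x).1).le.trans (h01 x).2
        simpa using integral_mono hi (integrable_const (1 : ℝ)) fun x => (h01 x).2
      have h4 : 0 ≤ ∫ x, f x ∂(Measure.pi fun _ => (Q : Measure Z)) :=
        integral_nonneg fun x => (h01 x).1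
      linarith) h2 hPU hPQ
  have e2 := hA.log_le hε hε1 (Real.sqrt_nonneg _) (fun f hf h01 => hG.integral_sub_le hf h01)
    h2 hPU hPQ
  have htr (D : ProbabilityMeasure Z) :
      ∫ x, (A.prob x {R | tvDist R P ≤ α}).toReal ∂(sampleLaw D n m) =
        (∫⁻ x, A.prob x {R | tvDist R P ≤ α} ∂(sampleLaw D n m)).toReal :=
    integral_toReal (A.measurable_prob _).aemeasurable
      (Filter.Eventually.of_forall fun x => (A.prob_le_one x _).trans_lt ENNReal.one_lt_top)
  have hfin : ∫⁻ x, A.prob x {R | tvDist R P ≤ α} ∂(sampleLaw P n m) ≠ ∞ := by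
    refine ((lintegral_mono fun x => A.prob_le_one x _).trans_lt ?_).ne
    simp
  have e3 := (hG.pi n).log_div_le (A.measurable_prob {R | tvDist R P ≤ α}).ennreal_toReal
    (fun x => ⟨ENNReal.toReal_nonneg, by
      simpa using ENNReal.toReal_mono ENNReal.one_ne_top (A.prob_le_one x _)⟩) h2
    (by
      refine le_of_le_of_eq ?_ (htr P).symm
      rw [← ENNReal.ofReal_le_iff_le_toReal hfin]
      exact hPU)
    (by
      refine (htr Q).le.trans ?_
      have h3 : (2 : ℝ) ≤ 𝓠.card := by exact_mod_cast h2
      have h4 : 0 < 3 * ((𝓠.card : ℝ) - 1) := by linarith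
      exact ENNReal.toReal_le_of_le_ofReal (by positivity) hPQ)
  change logSize 𝓠 ≤ _ at e1
  change logSize 𝓠 ≤ _ at e2
  change logSize 𝓠 / 20 ≤ _ at e3
  have hs : √((m : ℝ) * β / 2) ≤ √((m : ℝ) * β) := Real.sqrt_le_sqrt (by linarith)
  have hs0 : 0 < √((m : ℝ) * β) := Real.sqrt_pos.2 hmβ
  have f1 : logSize 𝓠 / ε ≤ 2 * n := by
    rw [div_le_iff₀ hε]
    linarith
  have f2 : logSize 𝓠 / (ε * √((m : ℝ) * β)) ≤ 2 * n := by
    rw [div_le_iff₀ (by positivity)]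
    exact e2.trans (by gcongr)
  have f3 : logSize 𝓠 / (m * β) ≤ 20 * n := by
    rw [div_le_iff₀ hmβ]
    linarith
  linarith

end LowerBound

/-! ### Sensitivity of a clipped binomial mean to the success probability -/

section Bernstein

open Polynomial

/-- The mean of `g` under the binomial distribution, as a polynomial in the success probability. -/
noncomputable def binomialMean (m : ℕ) (g : ℕ → ℝ) : ℝ[X] :=
  ∑ k ∈ Finset.range (m + 1), C (g k) * bernsteinPolynomial ℝ m k

theorem bernsteinPolynomial_eval_nonneg {m k : ℕ} {p : ℝ} (h0 : 0 ≤ p) (h1 : p ≤ 1) :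
    0 ≤ (bernsteinPolynomial ℝ m k).eval p := by
  have : 0 ≤ 1 - p := by linarith
  simp only [bernsteinPolynomial, eval_mul, eval_natCast, eval_pow, eval_X, eval_sub, eval_one]
  positivity

/-- Summation by parts turns the derivative in the success probability into the mean of the
increments of `g`, with one trial fewer. Bounds on increments of a clipped count thus become bounds
on slopes. -/
theorem derivative_binomialMean (m : ℕ) (g : ℕ → ℝ) :
    derivative (binomialMean (m + 1) g) =
      ((m : ℝ[X]) + 1) * binomialMean m fun k => g (k + 1) - g k := by
  have hlast : ∑ k ∈ Finset.range (m + 1), C (g (k + 1)) * bernsteinPolynomial ℝ m (k + 1) =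
      ∑ k ∈ Finset.range m, C (g (k + 1)) * bernsteinPolynomial ℝ m (k + 1) := by
    rw [Finset.sum_range_succ, bernsteinPolynomial.eq_zero_of_lt ℝ (Nat.lt_succ_self m)]
    simp
  have hfirst : ∑ k ∈ Finset.range (m + 1), C (g k) * bernsteinPolynomial ℝ m k =
      ∑ k ∈ Finset.range m, C (g (k + 1)) * bernsteinPolynomial ℝ m (k + 1) +
        C (g 0) * bernsteinPolynomial ℝ m 0 := Finset.sum_range_succ' _ _
  have hsplit : binomialMean m (fun k => g (k + 1) - g k) =
      ∑ k ∈ Finset.range (m + 1), C (g (k + 1)) * bernsteinPolynomial ℝ m k -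
        ∑ k ∈ Finset.range (m + 1), C (g k) * bernsteinPolynomial ℝ m k := by
    rw [binomialMean, ← Finset.sum_sub_distrib]
    exact Finset.sum_congr rfl fun k _ => by rw [C_sub, sub_mul]
  have hterm (k : ℕ) : derivative (C (g (k + 1)) * bernsteinPolynomial ℝ (m + 1) (k + 1)) =
      ((m : ℝ[X]) + 1) * (C (g (k + 1)) * bernsteinPolynomial ℝ m k -
        C (g (k + 1)) * bernsteinPolynomial ℝ m (k + 1)) := by
    rw [derivative_C_mul, bernsteinPolynomial.derivative_succ, Nat.add_sub_cancel, Nat.cast_succ]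
    ring
  rw [hsplit, binomialMean, Finset.sum_range_succ', derivative_add, derivative_sum,
    Finset.sum_congr rfl fun k _ => hterm k, ← Finset.mul_sum, Finset.sum_sub_distrib, hlast,
    hfirst, derivative_C_mul, bernsteinPolynomial.derivative_zero, Nat.add_sub_cancel,
    Nat.cast_succ]
  ring

theorem binomialMean_eval (m : ℕ) (g : ℕ → ℝ) (p : ℝ) :
    (binomialMean m g).eval p =
      ∑ k ∈ Finset.range (m + 1), g k * (bernsteinPolynomial ℝ m k).eval p := by
  simp [binomialMean, eval_finsetSum]

theorem sum_bernsteinPolynomial_eval (m : ℕ) (p : ℝ) :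
    ∑ k ∈ Finset.range (m + 1), (bernsteinPolynomial ℝ m k).eval p = 1 := by
  rw [← eval_finsetSum, bernsteinPolynomial.sum, eval_one]

/-- Chebyshev's inequality for the binomial distribution. -/
theorem binomialMean_ge_of_window {m : ℕ} {p w : ℝ} (h0 : 0 ≤ p) (h1 : p ≤ 1) (hw : 0 < w)
    (hmw : m ≤ w ^ 2) {g : ℕ → ℝ} {a : ℝ} (ha : 0 ≤ a) (hg : ∀ k, 0 ≤ g k)
    (hga : ∀ k : ℕ, |m * p - k| ≤ w → a ≤ g k) : 3 / 4 * a ≤ (binomialMean m g).eval p := by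
  have hvar : ∑ k ∈ Finset.range (m + 1), (m * p - k) ^ 2 * (bernsteinPolynomial ℝ m k).eval p =
      m * p * (1 - p) := by
    simpa [eval_finsetSum] using congrArg (eval p) (bernsteinPolynomial.variance ℝ m)
  -- Chebyshev through a pointwise minorant: the parabola is at most `a` in the window and
  -- nonpositive outside it.
  have hmono : ∑ k ∈ Finset.range (m + 1),
      a * (1 - (m * p - k) ^ 2 / w ^ 2) * (bernsteinPolynomial ℝ m k).eval p ≤
        (binomialMean m g).eval p := by
    rw [binomialMean_eval]
    refine Finset.sum_le_sum fun k _ =>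
      mul_le_mul_of_nonneg_right ?_ (bernsteinPolynomial_eval_nonneg h0 h1)
    by_cases hk : |m * p - k| ≤ w
    · refine le_trans ?_ (hga k hk)
      exact mul_le_of_le_one_right ha (sub_le_self _ (by positivity))
    · refine le_trans (mul_nonpos_of_nonneg_of_nonpos ha ?_) (hg k)
      rw [sub_nonpos, one_le_div (by positivity)]
      push Not at hk
      exact sq_le_sq.2 (by rw [abs_of_pos hw]; exact hk.le)
  have hsum : ∑ k ∈ Finset.range (m + 1),
      a * (1 - (m * p - k) ^ 2 / w ^ 2) * (bernsteinPolynomial ℝ m k).eval p =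
        a * (1 - m * p * (1 - p) / w ^ 2) := by
    calc
      _ = ∑ k ∈ Finset.range (m + 1), (a * (bernsteinPolynomial ℝ m k).eval p -
          a / w ^ 2 * ((m * p - k) ^ 2 * (bernsteinPolynomial ℝ m k).eval p)) :=
        Finset.sum_congr rfl fun k _ => by ring
      _ = a * 1 - a / w ^ 2 * (m * p * (1 - p)) := by
        rw [Finset.sum_sub_distrib, ← Finset.mul_sum, ← Finset.mul_sum, hvar,
          sum_bernsteinPolynomial_eval]
      _ = _ := by ring
  refine le_trans ?_ (hsum ▸ hmono)
  have hq : m * p * (1 - p) / w ^ 2 ≤ 1 / 4 := by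
    rw [div_le_iff₀ (by positivity)]
    nlinarith [sq_nonneg (2 * p - 1), Nat.cast_nonneg (α := ℝ) m, mul_nonneg h0 (sub_nonneg.2 h1)]
  nlinarith

/-- A binomial count, centered at `m * θ`, scaled, and clipped to `[-1, 1]`. -/
noncomputable def clippedCount (m : ℕ) (θ : ℝ) (k : ℕ) : ℝ :=
  max (-1) (min 1 ((k - m * θ) / (4 * √(m : ℝ))))

theorem abs_clippedCount_le (m : ℕ) (θ : ℝ) (k : ℕ) : |clippedCount m θ k| ≤ 1 :=
  abs_le.2 ⟨le_max_left _ _, max_le (by norm_num) (min_le_left _ _)⟩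

theorem clippedCount_mono (m : ℕ) (θ : ℝ) (k : ℕ) :
    0 ≤ clippedCount m θ (k + 1) - clippedCount m θ k := by
  rw [sub_nonneg]
  unfold clippedCount
  gcongr
  simp

theorem derivative_binomialMean_nonneg {m : ℕ} (θ : ℝ) {p : ℝ} (h0 : 0 ≤ p) (h1 : p ≤ 1) :
    0 ≤ (derivative (binomialMean (m + 1) (clippedCount (m + 1) θ))).eval p := by
  rw [derivative_binomialMean, eval_mul, binomialMean_eval]
  refine mul_nonneg ?_ (Finset.sum_nonneg fun k _ => mul_nonneg (clippedCount_mono _ _ _)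
    (bernsteinPolynomial_eval_nonneg h0 h1))
  simp only [eval_add, eval_natCast, eval_one]
  positivity

/-- For `p` within one standard scale of `θ`, clipping is inactive on the Chebyshev window. There
every increment is `1 / (4 * w)`, and the window carries mass at least `3 / 4`. -/
theorem derivative_binomialMean_ge {m : ℕ} {θ p : ℝ} (h0 : 0 ≤ p) (h1 : p ≤ 1)
    (hp : |p - θ| * √((m + 1 : ℕ) : ℝ) ≤ 1) :
    3 / 16 * √((m + 1 : ℕ) : ℝ) ≤
      (derivative (binomialMean (m + 1) (clippedCount (m + 1) θ))).eval p := by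
  set w := √((m + 1 : ℕ) : ℝ) with hw
  have hw2 : w ^ 2 = m + 1 := by
    rw [hw, Real.sq_sqrt (by positivity)]
    push_cast
    ring
  have hw1 : 1 ≤ w := by
    rw [hw, Real.one_le_sqrt]
    push_cast
    linarith [Nat.cast_nonneg (α := ℝ) m]
  have hwin := binomialMean_ge_of_window (m := m) (g := fun k =>
    clippedCount (m + 1) θ (k + 1) - clippedCount (m + 1) θ k) (a := 1 / (4 * w)) h0 h1
    (by linarith : 0 < w) (by linarith) (by positivity) (clippedCount_mono _ _) (by
      intro k hk
      have hd : |w ^ 2 * (p - θ)| ≤ w := by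
        rw [abs_mul, abs_of_nonneg (sq_nonneg w)]
        nlinarith
      rw [abs_le] at hk hd
      have e : ((m + 1 : ℕ) : ℝ) = w ^ 2 := by
        rw [hw2]
        push_cast
        ring
      have hm : (m : ℝ) = w ^ 2 - 1 := by linarith
      rw [hm] at hk
      -- The window and the offset `p - θ` each contribute at most `w`, and the passage between `m`
      -- and `m + 1` trials at most `1 ≤ w`; the clipping level `4 * w` leaves room for all three.
      have b1 : (((k + 1 : ℕ) : ℝ) - w ^ 2 * θ) / (4 * w) ≤ 1 := by
        rw [div_le_one (by positivity)]
        push_cast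
        nlinarith
      have b2 : -1 ≤ ((k : ℝ) - w ^ 2 * θ) / (4 * w) := by
        rw [le_div_iff₀ (by positivity)]
        nlinarith
      have b3 : (((k + 1 : ℕ) : ℝ) - w ^ 2 * θ) / (4 * w) =
          ((k : ℝ) - w ^ 2 * θ) / (4 * w) + 1 / (4 * w) := by
        push_cast
        ring
      have b4 : 0 < 1 / (4 * w) := by positivity
      simp only [clippedCount]
      rw [← hw, e, min_eq_right b1, min_eq_right (by linarith), max_eq_right (by linarith),
        max_eq_right b2]
      linarith)
  rw [derivative_binomialMean, eval_mul]
  simp only [eval_add, eval_natCast, eval_one]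
  rw [← hw2]
  calc
    3 / 16 * w = w ^ 2 * (3 / 4 * (1 / (4 * w))) := by
      field_simp
      norm_num
    _ ≤ _ := by gcongr

theorem monotoneOn_binomialMean (m : ℕ) (θ : ℝ) :
    MonotoneOn (fun p => (binomialMean (m + 1) (clippedCount (m + 1) θ)).eval p)
      (Set.Icc 0 1) := by
  refine monotoneOn_of_deriv_nonneg (convex_Icc 0 1) (Polynomial.continuous _).continuousOn
    (Polynomial.differentiable _).differentiableOn fun p hp => ?_
  rw [interior_Icc] at hp
  rw [Polynomial.deriv]
  exact derivative_binomialMean_nonneg θ hp.1.le hp.2.le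

theorem binomialMean_sub_ge_of_close {m : ℕ} {θ p q : ℝ} (h0 : 0 ≤ p) (hpq : p ≤ q)
    (h1 : q ≤ 1) (hp : |p - θ| * √((m + 1 : ℕ) : ℝ) ≤ 1)
    (hq : |q - θ| * √((m + 1 : ℕ) : ℝ) ≤ 1) :
    3 / 16 * √((m + 1 : ℕ) : ℝ) * (q - p) ≤
      (binomialMean (m + 1) (clippedCount (m + 1) θ)).eval q -
        (binomialMean (m + 1) (clippedCount (m + 1) θ)).eval p := by
  refine Convex.mul_sub_le_image_sub_of_le_deriv (convex_Icc p q)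
    (f := fun p => (binomialMean (m + 1) (clippedCount (m + 1) θ)).eval p)
    (Polynomial.continuous _).continuousOn (Polynomial.differentiable _).differentiableOn
    (fun x hx => ?_) p ⟨le_rfl, hpq⟩ q ⟨hpq, le_rfl⟩ hpq
  rw [interior_Icc] at hx
  rw [Polynomial.deriv]
  refine derivative_binomialMean_ge (h0.trans hx.1.le) (hx.2.le.trans h1) ?_
  have hs : |x - θ| ≤ max |p - θ| |q - θ| := by
    refine abs_le_max_abs_abs (by linarith [hx.1]) (by linarith [hx.2])
  rcases le_max_iff.1 hs with h | h
  · exact (mul_le_mul_of_nonneg_right h (Real.sqrt_nonneg _)).trans hp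
  · exact (mul_le_mul_of_nonneg_right h (Real.sqrt_nonneg _)).trans hq

theorem binomialMean_sub_ge {m : ℕ} {θ p δ : ℝ} (hθ0 : 0 ≤ θ) (hθ1 : θ ≤ 1) (h0 : 0 ≤ p)
    (h1 : p ≤ 1) (hδ : 0 ≤ δ) :
    (θ + δ ≤ p → 3 / 16 * min 1 (√((m + 1 : ℕ) : ℝ) * δ) ≤
      (binomialMean (m + 1) (clippedCount (m + 1) θ)).eval p -
        (binomialMean (m + 1) (clippedCount (m + 1) θ)).eval θ) ∧
    (p ≤ θ - δ → 3 / 16 * min 1 (√((m + 1 : ℕ) : ℝ) * δ) ≤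
      (binomialMean (m + 1) (clippedCount (m + 1) θ)).eval θ -
        (binomialMean (m + 1) (clippedCount (m + 1) θ)).eval p) := by
  set w := √((m + 1 : ℕ) : ℝ) with hw
  have hwpos : 0 < w := Real.sqrt_pos.2 (by positivity)
  -- The slope bound holds only within `1 / w` of `θ`. It is used up to distance `η`, and
  -- monotonicity carries the gain further.
  set η := min (1 / w) δ with hη
  have hη0 : 0 ≤ η := le_min (by positivity) hδ
  have hηδ : η ≤ δ := min_le_right _ _
  have hηw : η * w ≤ 1 := by
    rw [← le_div_iff₀ hwpos]
    exact min_le_left _ _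
  have hmin : min 1 (w * δ) = w * η := by
    rw [hη, mul_min_of_nonneg _ _ hwpos.le, mul_one_div_cancel hwpos.ne']
  have hmono := monotoneOn_binomialMean m θ
  rw [hmin]
  constructor
  · intro hp
    have a1 := binomialMean_sub_ge_of_close (m := m) (θ := θ) (p := θ) (q := θ + η) hθ0
      (by linarith) (by linarith) (by simp)
      (by rwa [add_sub_cancel_left, abs_of_nonneg hη0, ← hw])
    have a2 := hmono (a := θ + η) ⟨by linarith, by linarith⟩ ⟨h0, h1⟩ (by linarith)
    simp only at a2
    rw [← hw] at a1
    linarith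
  · intro hp
    have a1 := binomialMean_sub_ge_of_close (m := m) (p := θ - η) (θ := θ)
      (q := θ) (by linarith) (by linarith) (by linarith)
      (by rwa [sub_sub_cancel_left, abs_neg, abs_of_nonneg hη0, ← hw]) (by simp)
    have a2 := hmono (b := θ - η) ⟨h0, h1⟩ ⟨by linarith, by linarith⟩ (by linarith)
    simp only at a2
    rw [← hw] at a1
    linarith

end Bernstein

/-! ### The count of samples in a set is binomial -/

section Count

variable {Z : Type*}

open Classical in
/-- The number of the samples that lie in `E`. -/
noncomputable def countIn {m : ℕ} (E : Set Z) (z : Fin m → Z) : ℕ :=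
  (Finset.univ.filter fun j => z j ∈ E).card

-- Expanding over the possible sets `T` of indices of samples in `E` leaves products of one-sample
-- functions, which are measurable and integrate factor by factor under a product measure.
open Classical in
theorem apply_countIn {m : ℕ} (E : Set Z) (g : ℕ → ℝ) (z : Fin m → Z) :
    g (countIn E z) = ∑ T : Finset (Fin m), g T.card *
      ∏ j, (if j ∈ T then E.indicator (fun _ => (1 : ℝ)) (z j)
        else Eᶜ.indicator (fun _ => (1 : ℝ)) (z j)) := by
  rw [Finset.sum_eq_single (Finset.univ.filter fun j => z j ∈ E)]
  · rw [Finset.prod_eq_one, mul_one]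
    · rfl
    · intro j _
      by_cases hj : z j ∈ E <;> simp [hj]
  · intro T _ hT
    obtain ⟨j, hj⟩ : ∃ j, ¬(j ∈ T ↔ z j ∈ E) := by
      by_contra! hcon
      exact hT (Finset.ext fun j => by simpa using hcon j)
    rw [Finset.prod_eq_zero (Finset.mem_univ j), mul_zero]
    by_cases h : j ∈ T <;> simp_all
  · simp

variable [MeasurableSpace Z]

theorem measurable_apply_countIn {m : ℕ} {E : Set Z} (hE : MeasurableSet E) (g : ℕ → ℝ) :
    Measurable fun z : Fin m → Z => g (countIn E z) := by
  classical
  simp only [apply_countIn]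
  refine Finset.measurable_fun_sum _ fun T _ => Measurable.const_mul
    (Finset.measurable_fun_prod _ fun j _ => ?_) _
  split_ifs
  · exact (measurable_const.indicator hE).comp (measurable_pi_apply j)
  · exact (measurable_const.indicator hE.compl).comp (measurable_pi_apply j)

theorem integral_apply_countIn {m : ℕ} (D : Measure Z) [IsProbabilityMeasure D] {E : Set Z}
    (hE : MeasurableSet E) (g : ℕ → ℝ) :
    ∫ z, g (countIn E z) ∂(Measure.pi fun _ : Fin m => D) =
      (binomialMean m g).eval (D.real E) := by
  classical
  have hcompl : D.real Eᶜ = 1 - D.real E := by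
    rw [measureReal_compl hE, probReal_univ]
  have hprod (T : Finset (Fin m)) : ∫ z, ∏ j, (if j ∈ T then E.indicator (fun _ => (1 : ℝ)) (z j)
        else Eᶜ.indicator (fun _ => (1 : ℝ)) (z j)) ∂(Measure.pi fun _ : Fin m => D) =
      D.real E ^ T.card * (1 - D.real E) ^ (m - T.card) := by
    have h := integral_fintype_prod_eq_prod (𝕜 := ℝ) (μ := fun _ : Fin m => D) (fun j z =>
      if j ∈ T then E.indicator (fun _ => (1 : ℝ)) z else Eᶜ.indicator (fun _ => (1 : ℝ)) z)
    rw [h]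
    have hj (j : Fin m) : ∫ z, (if j ∈ T then E.indicator (fun _ => (1 : ℝ)) z
        else Eᶜ.indicator (fun _ => (1 : ℝ)) z) ∂D =
          if j ∈ T then D.real E else 1 - D.real E := by
      split_ifs
      · simp [integral_indicator_const _ hE]
      · simp [integral_indicator_const _ hE.compl, hcompl]
    rw [Finset.prod_congr rfl fun j _ => hj j, Finset.prod_ite, Finset.prod_const,
      Finset.prod_const, Finset.filter_mem_eq_inter, Finset.univ_inter, Finset.filter_not,
      Finset.filter_mem_eq_inter, Finset.univ_inter, ← Finset.compl_eq_univ_sdiff,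
      Finset.card_compl, Fintype.card_fin]
  simp only [apply_countIn]
  rw [integral_finsetSum]
  · simp only [integral_const_mul, hprod]
    have h := Finset.sum_powerset_apply_card (fun k => g k * (D.real E ^ k *
      (1 - D.real E) ^ (m - k))) (x := (Finset.univ : Finset (Fin m)))
    rw [Finset.powerset_univ, Finset.card_univ, Fintype.card_fin] at h
    rw [h, binomialMean_eval]
    refine Finset.sum_congr rfl fun k _ => ?_
    simp only [bernsteinPolynomial, Polynomial.eval_mul, Polynomial.eval_natCast,
      Polynomial.eval_pow, Polynomial.eval_X, Polynomial.eval_sub, Polynomial.eval_one,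
      nsmul_eq_mul]
    ring
  · intro T _
    refine Integrable.const_mul (integrable_of_abs_le (B := 1)
      (Finset.measurable_fun_prod _ fun j _ => ?_) fun z => ?_) _
    · split_ifs
      · exact (measurable_const.indicator hE).comp (measurable_pi_apply j)
      · exact (measurable_const.indicator hE.compl).comp (measurable_pi_apply j)
    · rw [Finset.abs_prod]
      refine Finset.prod_le_one (fun _ _ => abs_nonneg _) fun j _ => ?_
      by_cases h : z j ∈ E <;> by_cases hT : j ∈ T <;> simp [h, hT]

end Count

/-! ### Pairwise tests on the data of one user -/

section Test

variable {Z : Type u} [MeasurableSpace Z]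

theorem abs_binomialMean_clippedCount_le {m : ℕ} {θ p : ℝ} (h0 : 0 ≤ p) (h1 : p ≤ 1) :
    |(binomialMean m (clippedCount m θ)).eval p| ≤ 1 := by
  rw [binomialMean_eval, ← sum_bernsteinPolynomial_eval m p]
  refine (Finset.abs_sum_le_sum_abs _ _).trans (Finset.sum_le_sum fun k _ => ?_)
  rw [abs_mul, abs_of_nonneg (bernsteinPolynomial_eval_nonneg h0 h1)]
  exact mul_le_of_le_one_left (bernsteinPolynomial_eval_nonneg h0 h1) (abs_clippedCount_le _ _ _)

/-- The advantage of one user with `m` samples in a test between distributions whose distance is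
of order `α`. -/
noncomputable def advantage (m : ℕ) (α : ℝ) : ℝ := min 1 (√(m : ℝ) * α) / 50

/-- Passing to the complement reverses the sign of the difference, so the absolute value in `tvDist`
can be dropped. -/
theorem exists_scheffe_set {P Q : ProbabilityMeasure Z} {r : ℝ} (hr : r < tvDist P Q) :
    ∃ E : Set Z, MeasurableSet E ∧ (Q : Measure Z).real E + r < (P : Measure Z).real E := by
  have : Nonempty {E : Set Z // MeasurableSet E} := ⟨⟨∅, MeasurableSet.empty⟩⟩
  obtain ⟨⟨E, hE⟩, h⟩ := exists_lt_of_lt_ciSup hr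
  rcases lt_abs.1 h with h | h
  · exact ⟨E, hE, by linarith⟩
  · refine ⟨Eᶜ, hE.compl, ?_⟩
    rw [measureReal_compl hE, measureReal_compl hE, probReal_univ, probReal_univ]
    linarith

/-- A test between `P` and `Q` that reads the `m` samples of one user. -/
theorem exists_test {m : ℕ} (hm : 0 < m) {α : ℝ} (hα : 0 < α) (P Q : ProbabilityMeasure Z) :
    ∃ g : (Fin m → Z) → ℝ, Measurable g ∧ (∀ z, |g z| ≤ 1) ∧
      (0.9 * α ≤ tvDist P Q → ∀ D : ProbabilityMeasure Z,
        (tvDist P D ≤ 0.1 * α →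
          advantage m α ≤ ∫ z, g z ∂(Measure.pi fun _ => (D : Measure Z))) ∧
        (tvDist Q D ≤ 0.1 * α →
          ∫ z, g z ∂(Measure.pi fun _ => (D : Measure Z)) ≤ -advantage m α)) := by
  by_cases hfar : 0.9 * α ≤ tvDist P Q
  swap
  · exact ⟨fun _ => 0, measurable_const, by simp, fun h => absurd h hfar⟩
  obtain ⟨m, rfl⟩ := Nat.exists_eq_succ_of_ne_zero hm.ne'
  obtain ⟨E, hE, hPQ⟩ := exists_scheffe_set (P := P) (Q := Q) (r := 0.8 * α) (by linarith)
  have hP1 : (P : Measure Z).real E ≤ 1 := measureReal_le_one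
  have hP0 : 0 ≤ (P : Measure Z).real E := measureReal_nonneg
  have hQ1 : (Q : Measure Z).real E ≤ 1 := measureReal_le_one
  have hQ0 : 0 ≤ (Q : Measure Z).real E := measureReal_nonneg
  set θ := ((P : Measure Z).real E + (Q : Measure Z).real E) / 2 with hθ
  have hθ0 : 0 ≤ θ := by positivity
  have hθ1 : θ ≤ 1 := by linarith
  set c := (binomialMean (m + 1) (clippedCount (m + 1) θ)).eval θ with hc
  have hc1 : |c| ≤ 1 := abs_binomialMean_clippedCount_le hθ0 hθ1
  -- Subtracting `c` puts the zero of the mean at success probability `θ`; halving restores the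
  -- range `[-1, 1]`.
  set G : ℕ → ℝ := fun k => (clippedCount (m + 1) θ k - c) / 2 with hG
  have hGm : Measurable fun z : Fin (m + 1) → Z => clippedCount (m + 1) θ (countIn E z) :=
    measurable_apply_countIn hE _
  refine ⟨fun z => G (countIn E z), measurable_apply_countIn hE G, fun z => ?_, fun _ D => ?_⟩
  · have h1 := abs_clippedCount_le (m + 1) θ (countIn E z)
    rw [hG, abs_le]
    rw [abs_le] at h1 hc1
    constructor <;> simp only <;> linarith
  · have hD1 : (D : Measure Z).real E ≤ 1 := measureReal_le_one
    have hD0 : 0 ≤ (D : Measure Z).real E := measureReal_nonneg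
    have hint : ∫ z, G (countIn E z) ∂(Measure.pi fun _ : Fin (m + 1) => (D : Measure Z)) =
        ((binomialMean (m + 1) (clippedCount (m + 1) θ)).eval ((D : Measure Z).real E) - c) / 2 := by
      simp only [hG]
      rw [integral_div, integral_sub (integrable_of_abs_le hGm fun z => abs_clippedCount_le _ _ _)
        (integrable_const c), integral_apply_countIn _ hE]
      simp
    -- Both `P` and `Q` are at least `0.4 * α` from the midpoint `θ` on `E`, and `D` may be `0.1 *
    -- α` closer.
    have hgap := binomialMean_sub_ge (m := m) (δ := 0.3 * α) hθ0 hθ1 hD0 hD1 (by positivity)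
    have hadv : 2 * advantage (m + 1) α ≤
        3 / 16 * min 1 (√((m + 1 : ℕ) : ℝ) * (0.3 * α)) := by
      have hs : 0 ≤ √((m + 1 : ℕ) : ℝ) * α := by positivity
      rw [advantage, mul_left_comm]
      have h1 : 0.3 * min 1 (√((m + 1 : ℕ) : ℝ) * α) ≤
          min 1 (0.3 * (√((m + 1 : ℕ) : ℝ) * α)) := by
        rw [mul_min_of_nonneg _ _ (by norm_num)]
        exact min_le_min_right _ (by norm_num)
      have h2 : 0 ≤ min 1 (√((m + 1 : ℕ) : ℝ) * α) := le_min zero_le_one hs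
      linarith
    constructor
    · intro h
      have h1 := (abs_sub_le_tvDist P D hE).trans h
      rw [abs_le] at h1
      have h2 := hgap.1 (by linarith)
      rw [hint]
      linarith
    · intro h
      have h1 := (abs_sub_le_tvDist Q D hE).trans h
      rw [abs_le] at h1
      have h2 := hgap.2 (by linarith)
      rw [hint]
      linarith

/-- An antisymmetric system of tests. -/
theorem exists_antisymmetric_tests (Z : Type u) [MeasurableSpace Z] {m : ℕ} (hm : 0 < m) {α : ℝ}
    (hα : 0 < α) :
    ∃ g : ProbabilityMeasure Z → ProbabilityMeasure Z → (Fin m → Z) → ℝ,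
      (∀ P Q, Measurable (g P Q)) ∧ (∀ P Q z, |g P Q z| ≤ 1) ∧
      (∀ P Q z, g Q P z = -g P Q z) ∧
      ∀ P Q D : ProbabilityMeasure Z, 0.9 * α ≤ tvDist P Q → tvDist P D ≤ 0.1 * α →
        advantage m α ≤ ∫ z, g P Q z ∂(Measure.pi fun _ => (D : Measure Z)) := by
  choose g hgm hg1 hg using fun P Q : ProbabilityMeasure Z => exists_test hm hα P Q
  -- Both tests favor `P` near `P`, so antisymmetrizing keeps the full advantage.
  refine ⟨fun P Q z => (g P Q z - g Q P z) / 2, fun P Q => ((hgm P Q).sub (hgm Q P)).div_const 2,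
    fun P Q z => ?_, fun P Q z => by ring, fun P Q D hPQ hPD => ?_⟩
  · have h1 := abs_le.1 (hg1 P Q z)
    have h2 := abs_le.1 (hg1 Q P z)
    exact abs_le.2 ⟨by linarith, by linarith⟩
  · have h1 := (hg P Q hPQ D).1 hPD
    have h2 := (hg Q P (tvDist_comm P Q ▸ hPQ) D).2 hPD
    rw [integral_div, integral_sub (integrable_of_abs_le (hgm P Q) (hg1 P Q))
      (integrable_of_abs_le (hgm Q P) (hg1 Q P))]
    linarith

end Test

/-! ### Privacy and accuracy of the exponential mechanism -/

section ExponentialMechanism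

variable {O : Type v}

/-- The probability that the exponential mechanism with scores `s` selects `o`. -/
noncomputable def softmax (F : Finset O) (η : ℝ) (s : O → ℝ) (o : O) : ℝ :=
  Real.exp (η * s o) / ∑ p ∈ F, Real.exp (η * s p)

theorem sum_exp_pos {F : Finset O} (hF : F.Nonempty) (η : ℝ) (s : O → ℝ) :
    0 < ∑ p ∈ F, Real.exp (η * s p) :=
  Finset.sum_pos (fun _ _ => Real.exp_pos _) hF

theorem sum_softmax {F : Finset O} (hF : F.Nonempty) (η : ℝ) (s : O → ℝ) :
    ∑ o ∈ F, softmax F η s o = 1 := by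
  simp only [softmax]
  rw [← Finset.sum_div, div_self (sum_exp_pos hF η s).ne']

theorem softmax_nonneg (F : Finset O) (η : ℝ) (s : O → ℝ) (o : O) : 0 ≤ softmax F η s o := by
  unfold softmax
  positivity

/-- The numerator and the normalizing sum each change by a factor of at most `exp (η * b)`, hence
the `2`. -/
theorem softmax_le_exp_mul {F : Finset O} (hF : F.Nonempty) {η b : ℝ} (hη : 0 ≤ η) {s t : O → ℝ}
    (hst : ∀ o, |s o - t o| ≤ b) (o : O) :
    softmax F η s o ≤ Real.exp (2 * η * b) * softmax F η t o := by
  have h1 (p : O) : Real.exp (η * s p) ≤ Real.exp (η * b) * Real.exp (η * t p) := by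
    rw [← Real.exp_add, Real.exp_le_exp]
    nlinarith [(abs_le.1 (hst p)).2]
  have h2 : ∑ p ∈ F, Real.exp (η * t p) ≤
      Real.exp (η * b) * ∑ p ∈ F, Real.exp (η * s p) := by
    rw [Finset.mul_sum]
    refine Finset.sum_le_sum fun p _ => ?_
    rw [← Real.exp_add, Real.exp_le_exp]
    nlinarith [(abs_le.1 (hst p)).1]
  rw [softmax, softmax, mul_div_assoc', div_le_div_iff₀ (sum_exp_pos hF η s) (sum_exp_pos hF η t)]
  calc
    _ ≤ Real.exp (η * b) * Real.exp (η * t o) *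
        (Real.exp (η * b) * ∑ p ∈ F, Real.exp (η * s p)) :=
      mul_le_mul (h1 o) h2 (sum_exp_pos hF η t).le (by positivity)
    _ = _ := by
      rw [show 2 * η * b = η * b + η * b by ring, Real.exp_add]
      ring

theorem softmax_le_exp_sub {F : Finset O} (η : ℝ) (s : O → ℝ) {p : O} (hp : p ∈ F) (o : O) :
    softmax F η s o ≤ Real.exp (η * (s o - s p)) := by
  rw [mul_sub, Real.exp_sub, softmax]
  gcongr
  exact Finset.single_le_sum (f := fun p => Real.exp (η * s p)) (fun _ _ => (Real.exp_pos _).le) hp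

variable {Z : Type u} [MeasurableSpace Z] {n m : ℕ}

open Classical in
/-- The exponential mechanism. -/
noncomputable def expMechanism (F : Finset O) (hF : F.Nonempty) (η : ℝ)
    (s : Dataset Z n m → O → ℝ) (hs : ∀ o, Measurable fun x => s x o) : Algorithm Z O n m where
  law x := PMF.ofFinset (fun o => if o ∈ F then ENNReal.ofReal (softmax F η (s x) o) else 0) F
    (by
      rw [Finset.sum_congr rfl fun o ho => if_pos ho,
        ← ENNReal.ofReal_sum_of_nonneg fun o _ => softmax_nonneg F η (s x) o, sum_softmax hF,
        ENNReal.ofReal_one])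
    fun o ho => if_neg ho
  finite_output := ⟨F, fun x o ho => by
    by_contra h
    exact (PMF.mem_support_iff _ _).1 ho (PMF.ofFinset_apply_of_notMem _ _ h)⟩
  measurable_law o := by
    simp only [PMF.ofFinset_apply]
    split_ifs
    · refine Measurable.ennreal_ofReal (Measurable.div ((hs o).const_mul η).exp ?_)
      exact Finset.measurable_fun_sum _ fun p _ => ((hs p).const_mul η).exp
    · exact measurable_const

theorem expMechanism_isUserDP {F : Finset O} (hF : F.Nonempty) {η b : ℝ} (hη : 0 ≤ η)
    {s : Dataset Z n m → O → ℝ} (hs : ∀ o, Measurable fun x => s x o)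
    (hb : ∀ x y, UserNeighbors x y → ∀ o, |s x o - s y o| ≤ b) :
    (expMechanism F hF η s hs).IsUserDP (2 * η * b) 0 := by
  intro x y hxy S
  rw [ENNReal.ofReal_zero, add_zero]
  simp only [Algorithm.prob, PMF.toOuterMeasure_apply]
  rw [← ENNReal.tsum_mul_left]
  refine ENNReal.tsum_le_tsum fun o => ?_
  by_cases ho : o ∈ S
  · rw [Set.indicator_of_mem ho, Set.indicator_of_mem ho]
    simp only [expMechanism, PMF.ofFinset_apply]
    split_ifs
    · rw [← ENNReal.ofReal_mul (Real.exp_pos _).le]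
      exact ENNReal.ofReal_le_ofReal (softmax_le_exp_mul hF hη (hb x y hxy) o)
    · simp
  · simp [Set.indicator_of_notMem ho]

theorem expMechanism_prob_ge {F : Finset O} (hF : F.Nonempty) (η : ℝ)
    {s : Dataset Z n m → O → ℝ} (hs : ∀ o, Measurable fun x => s x o) (x : Dataset Z n m)
    {S : Set O} {b : ℝ} (hb0 : 0 ≤ b) (hb : ∀ o ∈ F, o ∉ S → softmax F η (s x) o ≤ b) :
    ENNReal.ofReal (1 - F.card * b) ≤ (expMechanism F hF η s hs).prob x S := by
  classical
  calc
    _ ≤ ENNReal.ofReal (∑ o ∈ F with o ∈ S, softmax F η (s x) o) := by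
      refine ENNReal.ofReal_le_ofReal ?_
      have h1 := Finset.sum_filter_add_sum_filter_not F (· ∈ S) (softmax F η (s x))
      rw [sum_softmax hF] at h1
      have h2 : ∑ o ∈ F with o ∉ S, softmax F η (s x) o ≤ F.card * b := by
        refine (Finset.sum_le_card_nsmul _ _ b fun o ho => ?_).trans ?_
        · rw [Finset.mem_filter] at ho
          exact hb o ho.1 ho.2
        · rw [nsmul_eq_mul]
          gcongr
          exact Finset.filter_subset _ _
      linarith
    _ = ∑ o ∈ F with o ∈ S, (expMechanism F hF η s hs).law x o := by
      rw [ENNReal.ofReal_sum_of_nonneg fun o _ => softmax_nonneg F η (s x) o]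
      refine Finset.sum_congr rfl fun o ho => ?_
      rw [Finset.mem_filter] at ho
      simp [expMechanism, PMF.ofFinset_apply, ho.1]
    _ ≤ _ := by
      rw [← PMF.toOuterMeasure_apply_finset]
      refine measure_mono fun o ho => ?_
      exact (Finset.mem_filter.1 ho).2

end ExponentialMechanism

/-! ### The upper bound: a private tournament over the cover -/

section UpperBound

variable {Z : Type u} [MeasurableSpace Z] {n m : ℕ}

/-- Hoeffding's inequality for the sum of a bounded statistic over the users. -/
theorem sampleLaw_sum_lt_le (D : ProbabilityMeasure Z) {g : (Fin m → Z) → ℝ} (hg : Measurable g)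
    (hg1 : ∀ z, |g z| ≤ 1) {γ : ℝ} (hγ0 : 0 ≤ γ)
    (hγ : γ ≤ ∫ z, g z ∂(Measure.pi fun _ => (D : Measure Z))) :
    (sampleLaw D n m).real {x | ∑ i, g (x i) < n * γ / 2} ≤ Real.exp (-(n * γ ^ 2 / 8)) := by
  rcases Nat.eq_zero_or_pos n with rfl | hn
  · simp
  set ν : Measure (Fin m → Z) := Measure.pi fun _ => (D : Measure Z) with hν
  have hbd (z : Fin m → Z) : -g z ∈ Set.Icc (-1 : ℝ) 1 := by
    have := abs_le.1 (hg1 z)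
    exact ⟨by linarith, by linarith⟩
  have hind : ProbabilityTheory.iIndepFun
      (fun (i : Fin n) (x : Dataset Z n m) => -g (x i) - ∫ z, -g z ∂ν) (sampleLaw D n m) :=
    ProbabilityTheory.iIndepFun_pi (μ := fun _ : Fin n => ν)
      (X := fun _ z => -g z - ∫ z, -g z ∂ν) fun _ => (hg.neg.sub_const _).aemeasurable
  have hsub (i : Fin n) : ProbabilityTheory.HasSubgaussianMGF
      (fun x : Dataset Z n m => -g (x i) - ∫ z, -g z ∂ν) 1 (sampleLaw D n m) := by
    have h1 := ProbabilityTheory.hasSubgaussianMGF_of_mem_Icc (μ := sampleLaw D n m)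
      (X := fun x => -g (x i)) (a := -1) (b := 1)
      (hg.neg.comp (measurable_pi_apply i)).aemeasurable (Filter.Eventually.of_forall fun x => hbd _)
    have h2 : ∫ x, -g (x i) ∂(sampleLaw D n m) = ∫ z, -g z ∂ν := by
      have h3 := measurePreserving_eval (fun _ : Fin n => ν) i
      rw [← h3.map_eq, integral_map (measurable_pi_apply i).aemeasurable
        hg.neg.aestronglyMeasurable]
      rfl
    rw [h2] at h1
    convert! h1 using 1
    norm_num
  -- The sum has variance proxy `n` and must deviate by half of its guaranteed mean `n * γ`.
  have h := ProbabilityTheory.HasSubgaussianMGF.measure_sum_ge_le_of_iIndepFun hind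
    (s := Finset.univ) (fun i _ => hsub i) (ε := n * γ / 2) (by positivity)
  refine (measureReal_mono fun x hx => ?_).trans (h.trans (le_of_eq ?_))
  · simp only [Set.mem_ofPred_eq] at hx ⊢
    rw [Finset.sum_sub_distrib, Finset.sum_neg_distrib, integral_neg]
    simp only [Finset.sum_const, Finset.card_univ, Fintype.card_fin, nsmul_eq_mul]
    have : (n : ℝ) * γ ≤ n * ∫ z, g z ∂ν := by gcongr
    linarith
  · have : (n : ℝ) ≠ 0 := by exact_mod_cast hn.ne'
    simp only [Finset.sum_const, Finset.card_univ, Fintype.card_fin, nsmul_eq_mul, mul_one,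
      NNReal.coe_natCast]
    congr 1
    field_simp
    ring

/-- `h1` pays for the union bound over the duels of a good candidate, `h2` for the union bound over
wrong outputs. Each fails with probability at most `1 / 6`. -/
theorem exists_algorithm {𝓟 : Set (ProbabilityMeasure Z)} (hm : 0 < m) {α ε : ℝ} (hα : 0 < α)
    (hε : 0 < ε) {𝓠 : Finset (ProbabilityMeasure Z)} (hne : 𝓠.Nonempty)
    (hcov : IsTVCover (0.1 * α) 𝓠 𝓟)
    (h1 : 𝓠.card * Real.exp (-(n * advantage m α ^ 2 / 8)) ≤ 1 / 6)
    (h2 : 𝓠.card * Real.exp (-(ε * (n * advantage m α) / 4)) ≤ 1 / 6) :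
    ∃ A : Algorithm Z (ProbabilityMeasure Z) n m,
      A.IsUserDP ε 0 ∧ A.IsUseful (dlearn 𝓟 α) (2 / 3) := by
  classical
  obtain ⟨g, hgm, hg1, hganti, hg⟩ := exists_antisymmetric_tests Z hm hα
  set γ := advantage m α with hγ
  have hγ0 : 0 ≤ γ := by
    rw [hγ, advantage]
    positivity
  have hγ1 : γ ≤ 1 := by
    have : min 1 (√(m : ℝ) * α) ≤ 1 := min_le_left _ _
    rw [hγ, advantage]
    linarith
  -- Close pairs cannot be tested and need not be: the value `n` is the largest a duel can take, so
  -- they do no harm to the minimum in `score`.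
  let duel : Dataset Z n m → ProbabilityMeasure Z → ProbabilityMeasure Z → ℝ := fun x P Q =>
    if 0.9 * α ≤ tvDist P Q then ∑ i, g P Q (x i) else n
  let score : Dataset Z n m → ProbabilityMeasure Z → ℝ := fun x P => 𝓠.inf' hne (duel x P)
  have hduelm (P Q) : Measurable fun x => duel x P Q := by
    simp only [duel]
    split_ifs
    · exact Finset.measurable_fun_sum _ fun i _ => (hgm P Q).comp (measurable_pi_apply i)
    · exact measurable_const
  have hscorem (P) : Measurable fun x => score x P := by
    have : Measurable (𝓠.inf' hne fun Q x => duel x P Q) :=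
      Finset.inf'_induction hne _ (fun _ h _ h' => h.inf h') fun Q _ => hduelm P Q
    convert! this using 1
    ext x
    simp [score]
  have hduel (x y : Dataset Z n m) (hxy : UserNeighbors x y) (P Q) :
      duel x P Q ≤ duel y P Q + 2 := by
    simp only [duel]
    split_ifs
    · obtain ⟨i, hi⟩ := hxy
      rw [← Finset.add_sum_erase _ _ (Finset.mem_univ i),
        ← Finset.add_sum_erase _ (fun i => g P Q (y i)) (Finset.mem_univ i),
        Finset.sum_congr rfl fun j hj => by rw [hi j (Finset.ne_of_mem_erase hj)]]
      linarith [(abs_le.1 (hg1 P Q (x i))).2, (abs_le.1 (hg1 P Q (y i))).1]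
    · linarith
  have hscore (x y : Dataset Z n m) (hxy : UserNeighbors x y) (P) :
      score x P ≤ score y P + 2 := by
    rw [← sub_le_iff_le_add]
    refine Finset.le_inf' hne _ fun Q hQ => ?_
    rw [sub_le_iff_le_add]
    exact (Finset.inf'_le _ hQ).trans (hduel x y hxy P Q)
  have hsymm (x y : Dataset Z n m) (hxy : UserNeighbors x y) : UserNeighbors y x := by
    obtain ⟨i, hi⟩ := hxy
    exact ⟨i, fun j hj => (hi j hj).symm⟩
  -- Scores have sensitivity `2`, and `2 * (ε / 4) * 2 = ε`.
  refine ⟨expMechanism 𝓠 hne (ε / 4) score hscorem, ?_, ?_⟩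
  · have := expMechanism_isUserDP hne (by positivity : 0 ≤ ε / 4) hscorem (b := 2)
      fun x y hxy P => abs_le.2 ⟨by linarith [hscore y x (hsymm x y hxy) P],
        by linarith [hscore x y hxy P]⟩
    convert this using 1
    ring
  · intro D hD
    obtain ⟨P, hP, hPD⟩ := hcov D hD
    set good : Set (Dataset Z n m) := {x | (n : ℝ) * γ / 2 ≤ score x P} with hgood
    have hgoodm : MeasurableSet good := measurableSet_le measurable_const (hscorem P)
    have hbad : (sampleLaw D n m).real goodᶜ ≤ 1 / 6 := by
      calc
        _ ≤ (sampleLaw D n m).real (⋃ Q ∈ 𝓠, {x | duel x P Q < n * γ / 2}) := by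
          refine measureReal_mono (fun x hx => ?_) (measure_ne_top _ _)
          simp only [hgood, Set.mem_compl_iff, Set.mem_ofPred_eq, not_le, score,
            Finset.inf'_lt_iff] at hx
          obtain ⟨Q, hQ, h⟩ := hx
          exact Set.mem_biUnion hQ h
        _ ≤ ∑ Q ∈ 𝓠, (sampleLaw D n m).real {x | duel x P Q < n * γ / 2} :=
          measureReal_biUnion_finset_le _ _
        _ ≤ ∑ Q ∈ 𝓠, Real.exp (-(n * γ ^ 2 / 8)) := by
          refine Finset.sum_le_sum fun Q _ => ?_
          by_cases hfar : 0.9 * α ≤ tvDist P Q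
          · simp only [duel, if_pos hfar]
            exact sampleLaw_sum_lt_le D (hgm P Q) (hg1 P Q) hγ0 (hg P Q D hfar hPD)
          · have : {x : Dataset Z n m | duel x P Q < n * γ / 2} = ∅ := by
              refine Set.eq_empty_of_forall_notMem fun x hx => ?_
              simp only [Set.mem_ofPred_eq, duel, if_neg hfar] at hx
              nlinarith [Nat.cast_nonneg (α := ℝ) n]
            rw [this, measureReal_empty]
            positivity
        _ ≤ 1 / 6 := by
          rw [Finset.sum_const, nsmul_eq_mul]
          exact h1
    have hgoodp : 5 / 6 ≤ (sampleLaw D n m).real good := by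
      rw [measureReal_compl hgoodm, probReal_univ] at hbad
      linarith
    have hprob (x) (hx : x ∈ good) : ENNReal.ofReal (5 / 6) ≤
        (expMechanism 𝓠 hne (ε / 4) score hscorem).prob x ((dlearn 𝓟 α).correct D) := by
      refine le_trans (ENNReal.ofReal_le_ofReal ?_) (expMechanism_prob_ge hne (ε / 4) hscorem x
        (b := Real.exp (-(ε * (n * γ) / 4))) (Real.exp_pos _).le fun Q hQ hQD => ?_)
      · linarith
      · refine (softmax_le_exp_sub _ _ hP Q).trans (Real.exp_le_exp.2 ?_)
        have hQD' : α < tvDist Q D := not_le.1 hQD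
        -- A wrong `Q` is far from `P`, so their duel is a real test. By antisymmetry `Q` scores at
        -- most minus the score of `P`, a gap of at least `n * γ`.
        have hfar : 0.9 * α ≤ tvDist P Q := by
          have := tvDist_triangle Q P D
          rw [tvDist_comm Q P] at this
          linarith
        have e1 : score x Q ≤ -∑ i, g P Q (x i) := by
          refine (Finset.inf'_le _ hP).trans (le_of_eq ?_)
          simp only [duel, if_pos (tvDist_comm P Q ▸ hfar), hganti P Q, Finset.sum_neg_distrib]
        have e2 : score x P ≤ ∑ i, g P Q (x i) := by
          refine (Finset.inf'_le _ hQ).trans (le_of_eq ?_)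
          simp only [duel, if_pos hfar]
        have e3 : (n : ℝ) * γ / 2 ≤ score x P := hx
        nlinarith
    calc
      -- `(5 / 6) ^ 2 = 25 / 36` exceeds `2 / 3`.
      ENNReal.ofReal (2 / 3) ≤ ENNReal.ofReal (5 / 6 * (sampleLaw D n m).real good) :=
        ENNReal.ofReal_le_ofReal (by linarith)
      _ = ∫⁻ _ in good, ENNReal.ofReal (5 / 6) ∂(sampleLaw D n m) := by
        rw [setLIntegral_const, ENNReal.ofReal_mul (by norm_num), ofReal_measureReal]
      _ ≤ ∫⁻ x in good, (expMechanism 𝓠 hne (ε / 4) score hscorem).prob x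
          ((dlearn 𝓟 α).correct D) ∂(sampleLaw D n m) := setLIntegral_mono' hgoodm hprob
      _ ≤ _ := setLIntegral_le_lintegral _ _

theorem userComplexity_le {O : Type v} {T : Task Z O} {ε δ : ℝ}
    (h : ∃ A : Algorithm Z O n m, A.IsUserDP ε δ ∧ A.IsUseful T (2 / 3)) :
    userComplexity T m ε δ ≤ n :=
  iInf₂_le (f := fun (n : ℕ) (_ : n ∈ {n : ℕ | ∃ A : Algorithm Z O n m,
    A.IsUserDP ε δ ∧ A.IsUseful T (2 / 3)}) => (n : ℕ∞)) n h

/-- A singleton cover makes `f = 0`, so the bound allows no users at all; the only candidate is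
output without looking at data. -/
theorem exists_algorithm_of_card_eq_one {𝓟 : Set (ProbabilityMeasure Z)} {α ε : ℝ} (hα : 0 < α)
    (hε : 0 < ε) {𝓠 : Finset (ProbabilityMeasure Z)} (h1 : 𝓠.card = 1)
    (hcov : IsTVCover (0.1 * α) 𝓠 𝓟) :
    ∃ A : Algorithm Z (ProbabilityMeasure Z) n m,
      A.IsUserDP ε 0 ∧ A.IsUseful (dlearn 𝓟 α) (2 / 3) := by
  have hne : 𝓠.Nonempty := Finset.card_pos.1 (by omega)
  refine ⟨expMechanism 𝓠 hne (ε / 4) (fun _ _ => 0) fun _ => measurable_const, ?_, fun D hD => ?_⟩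
  · have := expMechanism_isUserDP (Z := Z) (n := n) (m := m) hne (by positivity : 0 ≤ ε / 4)
      (s := fun _ _ => 0) (fun _ => measurable_const) (b := 2) (by simp)
    convert this using 1
    ring
  · obtain ⟨P, hP, hPD⟩ := hcov D hD
    have hprob (x : Dataset Z n m) : ENNReal.ofReal (2 / 3) ≤
        (expMechanism 𝓠 hne (ε / 4) (fun _ _ => 0) fun _ => measurable_const).prob x
          ((dlearn 𝓟 α).correct D) := by
      refine le_trans (ENNReal.ofReal_le_ofReal ?_) (expMechanism_prob_ge hne (ε / 4) _ x
        (b := 0) le_rfl fun Q hQ hQD => ?_)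
      · norm_num
      · rw [Finset.card_le_one.1 h1.le Q hQ P hP] at hQD
        refine absurd ?_ hQD
        change tvDist P D ≤ α
        linarith
    calc
      ENNReal.ofReal (2 / 3) = ∫⁻ _, ENNReal.ofReal (2 / 3) ∂(sampleLaw D n m) := by simp
      _ ≤ _ := lintegral_mono hprob

theorem upper_bound {𝓟 : Set (ProbabilityMeasure Z)} (hm : 0 < m) {α ε : ℝ} (hα : 0 < α)
    (hε : 0 < ε) (hε1 : ε ≤ 1) {𝓠 : Finset (ProbabilityMeasure Z)} (hne : 𝓠.Nonempty)
    (hcov : IsTVCover (0.1 * α) 𝓠 𝓟) {f : ℝ}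
    (hf : f = logSize 𝓠 / ε + logSize 𝓠 / (α * ε * √(m : ℝ)) + logSize 𝓠 / (α ^ 2 * m)) :
    ∃ n : ℕ, (n : ℝ) ≤ 100000 * f ∧ ∃ A : Algorithm Z (ProbabilityMeasure Z) n m,
      A.IsUserDP ε 0 ∧ A.IsUseful (dlearn 𝓟 α) (2 / 3) := by
  have hcard := Finset.card_pos.2 hne
  rcases Nat.lt_or_ge 𝓠.card 2 with h2 | h2
  · have h1 : 𝓠.card = 1 := by omega
    refine ⟨0, ?_, exists_algorithm_of_card_eq_one hα hε h1 hcov⟩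
    simp [hf, logSize, h1]
  have hk : (2 : ℝ) ≤ 𝓠.card := by exact_mod_cast h2
  set L := logSize 𝓠 with hL
  set s := √(m : ℝ) * α with hs
  have hmpos : (0 : ℝ) < m := by exact_mod_cast hm
  have hspos : 0 < s := by positivity
  have hLlow : 1 / 2 ≤ L := by
    have h3 : Real.log 2 ≤ L := Real.log_le_log (by norm_num) hk
    linarith [Real.log_two_gt_d9]
  have hf' : f = L / ε + L / (ε * s) + L / s ^ 2 := by
    rw [hf, hs, mul_pow, Real.sq_sqrt hmpos.le]
    congr 2
    · congr 1
      ring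
    · ring
  have hLε : L ≤ L / ε := by
    rw [le_div_iff₀ hε]
    nlinarith
  have hp1 : 0 ≤ L / (ε * s) := by positivity
  have hp2 : 0 ≤ L / s ^ 2 := by positivity
  -- The requirement `n * γ ^ 2 / 8 ≥ 4 * L` with `γ = min 1 s / 50` needs `80000 = 8 * 4 * 50 ^ 2`;
  -- the privacy requirement needs only `800`. Rounding up is absorbed because `f ≥ L ≥ 1 / 2`.
  set n := ⌈80000 * f⌉₊ with hn
  have hnlow : 80000 * f ≤ n := Nat.le_ceil _
  have hnup : (n : ℝ) ≤ 100000 * f := by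
    have := Nat.ceil_lt_add_one (a := 80000 * f) (by linarith)
    linarith
  have hlog : Real.log (6 * 𝓠.card) ≤ 4 * L := by
    rw [hL, logSize, show (4 : ℝ) * Real.log 𝓠.card = ((4 : ℕ) : ℝ) * Real.log 𝓠.card by norm_num,
      ← Real.log_pow]
    refine Real.log_le_log (by linarith) ?_
    have : (2 : ℝ) ^ 3 ≤ (𝓠.card : ℝ) ^ 3 := pow_le_pow_left₀ (by norm_num) hk 3
    nlinarith
  have hfail {t : ℝ} (ht : 4 * L ≤ t) : 𝓠.card * Real.exp (-t) ≤ 1 / 6 := by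
    have h3 : 6 * (𝓠.card : ℝ) ≤ Real.exp t := by
      rw [← Real.log_le_iff_le_exp (by linarith)]
      linarith
    rw [Real.exp_neg, ← div_eq_mul_inv, div_le_iff₀ (Real.exp_pos t)]
    linarith
  have hadv : advantage m α = min 1 s / 50 := rfl
  refine ⟨n, hnup, exists_algorithm hm hα hε hne hcov (hfail ?_) (hfail ?_)⟩ <;> rw [hadv]
  · rcases le_total 1 s with h | h
    · rw [min_eq_left h]
      linarith
    · rw [min_eq_right h]
      have h3 : 80000 * (L / s ^ 2) ≤ n := by linarith
      rw [mul_div_assoc', div_le_iff₀ (by positivity)] at h3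
      linarith
  · rcases le_total 1 s with h | h
    · rw [min_eq_left h]
      have h3 : 80000 * (L / ε) ≤ n := by linarith
      rw [mul_div_assoc', div_le_iff₀ hε] at h3
      linarith
    · rw [min_eq_right h]
      have h3 : 80000 * (L / (ε * s)) ≤ n := by linarith
      rw [mul_div_assoc', div_le_iff₀ (by positivity)] at h3
      linarith

end UpperBound

end UserDP

theorem theoremE5 :
    ∃ κ : ℝ, 0 < κ ∧ ∃ C : ℝ, 0 < C ∧ ∃ c : ℕ,
      ∀ (Z : Type u) [MeasurableSpace Z] (𝓟 : Set (ProbabilityMeasure Z)) (m : ℕ), 0 < m →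
      ∀ α ε : ℝ, 0 < α → α ≤ κ → 0 < ε → ε ≤ κ →
        (∀ 𝓠 : Finset (ProbabilityMeasure Z), 𝓠.Nonempty → UserDP.IsTVCover (0.1 * α) 𝓠 𝓟 →
          ∀ L f : ℝ, L = UserDP.logSize 𝓠 →
            f = L / ε + L / (α * ε * √(m : ℝ)) + L / (α ^ 2 * m) →
            (UserDP.userComplexity (UserDP.dlearn 𝓟 α) m ε 0 : ℝ≥0∞) ≤
              ENNReal.ofReal (C * (f * UserDP.polylog c f))) ∧
        (∀ β : ℝ, 0 < β → β ≤ κ →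
          ∀ 𝓠 : Finset (ProbabilityMeasure Z), UserDP.IsTVPacking (3 * α) 𝓠 𝓟 →
          UserDP.klDiam 𝓠 ≤ ENNReal.ofReal β →
          ∀ L f : ℝ, L = UserDP.logSize 𝓠 →
            f = L / ε + L / (ε * √((m : ℝ) * β)) + L / (m * β) →
            ENNReal.ofReal (C⁻¹ * (f / UserDP.polylog c f)) ≤
              (UserDP.userComplexity (UserDP.dlearn 𝓟 α) m ε 0 : ℝ≥0∞)) := by
  -- The exponent `0` makes `polylog` equal to `1`.
  refine ⟨1, one_pos, 100000, by norm_num, 0, ?_⟩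
  intro Z _ 𝓟 m hm α ε hα _ hε hε1
  refine ⟨?_, ?_⟩
  · intro 𝓠 hne hcov L f hL hf
    subst hL
    obtain ⟨n, hn, hA⟩ := UserDP.upper_bound hm hα hε hε1 hne hcov hf
    calc
      (UserDP.userComplexity (UserDP.dlearn 𝓟 α) m ε 0 : ℝ≥0∞) ≤ ((n : ℕ∞) : ℝ≥0∞) :=
        ENat.toENNReal_mono (UserDP.userComplexity_le hA)
      _ = ENNReal.ofReal n := by simp
      _ ≤ _ := ENNReal.ofReal_le_ofReal (by simpa [UserDP.polylog] using hn)
  · intro β hβ _ 𝓠 hpack hdiam L f hL hf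
    subst hL
    -- Comparing with a ceiling inside `ℕ∞` lets the infimum be bounded term by term, including when
    -- no `n` is feasible.
    have hlow : ((⌈(100000 : ℝ)⁻¹ * f⌉₊ : ℕ) : ℕ∞) ≤
        UserDP.userComplexity (UserDP.dlearn 𝓟 α) m ε 0 := by
      refine le_iInf₂ fun n ⟨A, hA, hU⟩ => ?_
      have h := UserDP.lower_bound hm hα hε hε1 hβ hpack hdiam hA hU
      rw [← hf] at h
      rw [Nat.cast_le, Nat.ceil_le]
      have := Nat.cast_nonneg (α := ℝ) n
      linarith
    calc
      _ ≤ ENNReal.ofReal ((⌈(100000 : ℝ)⁻¹ * f⌉₊ : ℕ) : ℝ) :=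
        ENNReal.ofReal_le_ofReal (by simpa [UserDP.polylog] using Nat.le_ceil _)
      _ = (((⌈(100000 : ℝ)⁻¹ * f⌉₊ : ℕ) : ℕ∞) : ℝ≥0∞) := by simp
      _ ≤ _ := ENat.toENNReal_mono hlow
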